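/- Let $n\ge 3$, let $\Omega\subseteq\mathbb{R}^n$ be open, and let $V:\Omega\to\mathbb{R}$ be an upper semicontinuous function with $V\le 0$ that belongs to the Kato class, that is, $$\lim_{\alpha\downarrow 0}\ \sup_{x\in\mathbb{R}^n}\int_{\Omega\cap B(x,\alpha)}|x-y|^{2-n}\,|V(y)|\,dy=0 .$$ For a densely defined, lower semibounded, closed quadratic form $(\mathcal{E},\mathcal{F})$ on a complex Hilbert space with associated self-adjoint operator $L$ and spectral measure $E^L$, and for $\beta\in\mathbb{R}$, put $N((\mathcal{E},\mathcal{F}),\beta):=\mathrm{Tr}\,E^L((-\infty,\beta])\in\{0,1,2,\dots,\infty\}$ (the number of eigenvalues not exceeding $\beta$, counted with multiplicity). Let $$\mathcal{Q}_V[u]:=\int_\Omega|\nabla u|^2\,dx+\int_\Omega|u|^2\,V\,dx,\qquad u\in H^1_0(\Omega,dx),$$ be the quadratic form on $L^2(\Omega,dx)$ of the Schrödinger operator $-\Delta+V$, where $H^1_0(\Omega,dx)$ is the closure of $C_c^\infty(\Omega)$ in the norm $(\|u\|^2_{L^2}+\|\nabla u\|^2_{L^2})^{1/2}$. For $e\le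 0$ let $U_e:=\{x\in\Omega: V(x)<e\}$ and $m_e(dx):=(V-e)_-\,dx$ on $U_e$, where $(V-e)_-=\max(e-V,0)$, and consider on $L^2(U_e,m_e)$ the Dirichlet integral $$\mathcal{D}_{U_e}[u]:=\int_{U_e}|\nabla u|^2\,dx,\qquad u\in H^1(U_e,m_e),$$ where $H^1(U_e,m_e):=\{u\in L^2(U_e,m_e)\cap L^2_{\rm loc}(U_e,dx): |\nabla u|\in L^2(U_e,dx)\}$. Then for all $e\le 0$ and all $\lambda\ge 1$, $$N\big((\mathcal{Q}_V,H^1_0(\Omega,dx)),e\big)\ \le\ N\big((\mathcal{D}_{U_e},H^1(U_e,m_e)),\lambda\big).$$ -/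

import Mathlib

open MeasureTheory Set Filter Topology
open scoped ENNReal InnerProductSpace ContDiff

noncomputable section

/-! ### Spectral measures and eigenvalue counting functions of quadratic forms -/

section Spectral

variable (H : Type*) [NormedAddCommGroup H] [InnerProductSpace ℂ H] [CompleteSpace H]

/-- A projection-valued measure on the Borel sets of `ℝ`, acting on the Hilbert space `H`: every
Borel set is sent to an orthogonal projection, the whole line is sent to the identity, and the
assignment is countably additive in the strong operator topology. -/
structure ProjectionValuedMeasure where
  /-- The operator attached to a set; only its values on Borel sets matter. -/
  proj : Set ℝ → H →L[ℂ] H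
  isStarProjection : ∀ B, MeasurableSet B → IsStarProjection (proj B)
  proj_univ : proj univ = 1
  hasSum_iUnion : ∀ B : ℕ → Set ℝ, (∀ i, MeasurableSet (B i)) →
    Pairwise (fun i j => Disjoint (B i) (B j)) →
    ∀ x : H, HasSum (fun i => proj (B i) x) (proj (⋃ i, B i) x)

variable {H}

namespace ProjectionValuedMeasure

theorem proj_empty (E : ProjectionValuedMeasure H) (x : H) : E.proj ∅ x = 0 := by
  have h := E.hasSum_iUnion (fun _ => ∅) (fun _ => MeasurableSet.empty)
    (fun _ _ _ => disjoint_bot_left) x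
  exact (summable_const_iff _).1 h.summable

theorem inner_proj_self (E : ProjectionValuedMeasure H) {B : Set ℝ} (hB : MeasurableSet B)
    (x : H) : ⟪x, E.proj B x⟫_ℂ = ((‖E.proj B x‖ ^ 2 : ℝ) : ℂ) := by
  have h := E.isStarProjection B hB
  have h1 : E.proj B (E.proj B x) = E.proj B x :=
    congrArg (fun T : H →L[ℂ] H => T x) h.isIdempotentElem.eq
  have h2 : ContinuousLinearMap.adjoint (E.proj B) = E.proj B := h.isSelfAdjoint.star_eq
  calc ⟪x, E.proj B x⟫_ℂ = ⟪x, E.proj B (E.proj B x)⟫_ℂ := by rw [h1]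
    _ = ⟪ContinuousLinearMap.adjoint (E.proj B) x, E.proj B x⟫_ℂ := by
        rw [ContinuousLinearMap.adjoint_inner_left]
    _ = ((‖E.proj B x‖ ^ 2 : ℝ) : ℂ) := by
        rw [h2, inner_self_eq_norm_sq_to_K]; push_cast; rfl

/-- The scalar spectral measure `B ↦ ⟪x, E(B) x⟫ = ‖E(B) x‖²`. -/
def scalarMeasure (E : ProjectionValuedMeasure H) (x : H) : Measure ℝ :=
  Measure.ofMeasurable (fun B _ => ENNReal.ofReal (‖E.proj B x‖ ^ 2))
    (by simp [E.proj_empty x])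
    (by
      intro B hB hd
      have h0 := (E.hasSum_iUnion B hB hd x).mapL (innerSL ℂ x)
      simp only [innerSL_apply_apply, E.inner_proj_self (hB _),
        E.inner_proj_self (MeasurableSet.iUnion hB)] at h0
      have h1 := Complex.hasSum_ofReal.1 h0
      rw [← h1.tsum_eq, ENNReal.ofReal_tsum_of_nonneg (fun i => by positivity) h1.summable])

/-- `E` is the spectral measure of the (possibly unbounded) operator `L`, that is
`L = ∫ t dE(t)`: the domain of `L` consists of the `u` with `∫ t² d⟪u, E(t) u⟫ < ∞`, and
`⟪u, L u⟫ = ∫ t d⟪u, E(t) u⟫` on it. -/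
def IsSpectralMeasureOf (E : ProjectionValuedMeasure H) (L : H →ₗ.[ℂ] H) : Prop :=
  (∀ u : H, u ∈ L.domain ↔ ∫⁻ t, ENNReal.ofReal (t ^ 2) ∂(E.scalarMeasure u) < ⊤) ∧
  ∀ u : L.domain, ⟪(u : H), L u⟫_ℂ = ((∫ t, t ∂(E.scalarMeasure (u : H)) : ℝ) : ℂ)

end ProjectionValuedMeasure

variable (H) in
/-- A form on a Hilbert space: a domain `𝓕` and a function `(u, v) ↦ 𝓔(u, v)` (conjugate linear in
`u`, like the inner product of Mathlib), of which only the values on `𝓕 × 𝓕` matter. The quadratic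
form is `𝓔[u] = 𝓔(u, u)`. -/
structure HilbertForm where
  domain : Submodule ℂ H
  toFun : H → H → ℂ

/-- `L` is the operator of the form `(𝓔, 𝓕)`: `u ∈ D(L)` and `L u = w` if and only if `u ∈ 𝓕` and
`𝓔(v, u) = ⟪v, w⟫` for all `v ∈ 𝓕`. -/
def HilbertForm.IsOperatorOf (q : HilbertForm H) (L : H →ₗ.[ℂ] H) : Prop :=
  ∀ u w : H, (u, w) ∈ L.graph ↔ u ∈ q.domain ∧ ∀ v ∈ q.domain, q.toFun v u = ⟪v, w⟫_ℂ

open Classical in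
/-- The counting function `N((𝓔, 𝓕), β) = Tr E^L((-∞, β])`, where `E^L` is the spectral measure of
the self-adjoint operator `L` of the form; the trace of the orthogonal projection `E^L((-∞, β])` is
the dimension of its range, in `{0, 1, …, ∞}`. A lower semibounded, densely defined, closed form
has exactly one operator, and this operator has exactly one spectral measure. (Forms without them
get the value `0`.) -/
def HilbertForm.countingFunction (q : HilbertForm H) (β : ℝ) : ℕ∞ :=
  if h : ∃ E : ProjectionValuedMeasure H, ∃ L : H →ₗ.[ℂ] H,
      q.IsOperatorOf L ∧ E.IsSpectralMeasureOf L then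
    (Module.rank ℂ (h.choose.proj (Iic β)).range).toENat
  else 0

end Spectral

/-! ### Sobolev spaces and Dirichlet integrals -/

section Sobolev

variable {n : ℕ}

/-- `C_c^∞(Ω)`, complex valued. -/
def IsTestFunction (Ω : Set (EuclideanSpace ℝ (Fin n))) (φ : EuclideanSpace ℝ (Fin n) → ℂ) : Prop :=
  ContDiff ℝ ∞ φ ∧ HasCompactSupport φ ∧ tsupport φ ⊆ Ω

/-- The classical gradient of a complex-valued function. -/
def classicalGradient (φ : EuclideanSpace ℝ (Fin n) → ℂ) (x : EuclideanSpace ℝ (Fin n)) :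
    EuclideanSpace ℂ (Fin n) :=
  WithLp.toLp 2 fun i => fderiv ℝ φ x (EuclideanSpace.single i 1)

/-- `L²(Ω, dx; ℂⁿ)`. -/
abbrev L2Field (Ω : Set (EuclideanSpace ℝ (Fin n))) : Type :=
  Lp (EuclideanSpace ℂ (Fin n)) 2 (volume.restrict Ω)

/-- `G` is the weak gradient of `u` on `Ω`. -/
def IsWeakGradient (Ω : Set (EuclideanSpace ℝ (Fin n))) (u : EuclideanSpace ℝ (Fin n) → ℂ)
    (G : EuclideanSpace ℝ (Fin n) → EuclideanSpace ℂ (Fin n)) : Prop :=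
  ∀ φ : EuclideanSpace ℝ (Fin n) → ℂ, IsTestFunction Ω φ → ∀ i : Fin n,
    ∫ x in Ω, u x * classicalGradient φ x i = -∫ x in Ω, G x i * φ x

/-- `u ∈ L²_loc(Ω, dx)`. -/
def IsL2Loc (Ω : Set (EuclideanSpace ℝ (Fin n))) (u : EuclideanSpace ℝ (Fin n) → ℂ) : Prop :=
  ∀ K : Set (EuclideanSpace ℝ (Fin n)), IsCompact K → K ⊆ Ω → MemLp u 2 (volume.restrict K)

/-- The Beppo Levi functions on `Ω`: `u ∈ L²_loc(Ω, dx)` with weak gradient in `L²(Ω, dx)`. -/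
def IsBeppoLevi (Ω : Set (EuclideanSpace ℝ (Fin n))) (u : EuclideanSpace ℝ (Fin n) → ℂ) : Prop :=
  IsL2Loc Ω u ∧ ∃ G : L2Field Ω, IsWeakGradient Ω u G

theorem IsTestFunction.zero {Ω : Set (EuclideanSpace ℝ (Fin n))} : IsTestFunction Ω 0 :=
  ⟨contDiff_const, HasCompactSupport.zero, by simp [tsupport]⟩

theorem IsTestFunction.add {Ω : Set (EuclideanSpace ℝ (Fin n))}
    {φ ψ : EuclideanSpace ℝ (Fin n) → ℂ} (hφ : IsTestFunction Ω φ) (hψ : IsTestFunction Ω ψ) :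
    IsTestFunction Ω (φ + ψ) :=
  ⟨hφ.1.add hψ.1, hφ.2.1.add hψ.2.1,
    (tsupport_add φ ψ).trans (union_subset hφ.2.2 hψ.2.2)⟩

theorem IsTestFunction.const_smul {Ω : Set (EuclideanSpace ℝ (Fin n))}
    {φ : EuclideanSpace ℝ (Fin n) → ℂ} (c : ℂ) (hφ : IsTestFunction Ω φ) :
    IsTestFunction Ω (c • φ) :=
  ⟨hφ.1.const_smul c, hφ.2.1.smul_left (f := fun _ => c),
    (closure_mono (Function.support_const_smul_subset c φ)).trans hφ.2.2⟩

theorem classicalGradient_zero :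
    classicalGradient (0 : EuclideanSpace ℝ (Fin n) → ℂ) = 0 := by
  ext x i; simp [classicalGradient]

theorem classicalGradient_add {φ ψ : EuclideanSpace ℝ (Fin n) → ℂ} (hφ : ContDiff ℝ ∞ φ)
    (hψ : ContDiff ℝ ∞ ψ) :
    classicalGradient (φ + ψ) = classicalGradient φ + classicalGradient ψ := by
  ext x i
  simp [classicalGradient, fderiv_add (hφ.differentiable (by simp) x)
    (hψ.differentiable (by simp) x)]

theorem classicalGradient_smul {φ : EuclideanSpace ℝ (Fin n) → ℂ} (c : ℂ)
    (hφ : ContDiff ℝ ∞ φ) : classicalGradient (c • φ) = c • classicalGradient φ := by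
  ext x i
  simp [classicalGradient, fderiv_const_smul (hφ.differentiable (by simp) x) c]

theorem IsTestFunction.integrable_mul {Ω : Set (EuclideanSpace ℝ (Fin n))}
    {u : EuclideanSpace ℝ (Fin n) → ℂ} (hu : IsL2Loc Ω u) {K : Set (EuclideanSpace ℝ (Fin n))}
    (hK : IsCompact K) (hKΩ : K ⊆ Ω) {g : EuclideanSpace ℝ (Fin n) → ℂ} (hg : Continuous g)
    (hgK : ∀ x ∉ K, g x = 0) : Integrable (fun x => u x * g x) (volume.restrict Ω) := by
  have hfin : IsFiniteMeasure (volume.restrict K) := ⟨by simpa using hK.measure_lt_top⟩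
  have h1 : IntegrableOn (fun x => u x * g x) K := by
    have h2 : IntegrableOn u K := (hu K hK hKΩ).integrable (by norm_num)
    exact h2.mul_continuousOn hg.continuousOn hK
  have h3 : Integrable (fun x => u x * g x) volume := by
    refine (integrableOn_iff_integrable_of_support_subset ?_).1 h1
    intro x hx
    by_contra hxK
    exact hx (by simp [hgK x hxK])
  exact h3.integrableOn

theorem isL2Loc_of_memLp {Ω : Set (EuclideanSpace ℝ (Fin n))}
    {u : EuclideanSpace ℝ (Fin n) → ℂ} (hu : MemLp u 2 (volume.restrict Ω)) : IsL2Loc Ω u :=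
  fun _ _ hK => hu.mono_measure (Measure.restrict_mono hK le_rfl)

theorem IsTestFunction.integrable_mul_classicalGradient {Ω : Set (EuclideanSpace ℝ (Fin n))}
    {u : EuclideanSpace ℝ (Fin n) → ℂ} (hu : IsL2Loc Ω u) {φ : EuclideanSpace ℝ (Fin n) → ℂ}
    (hφ : IsTestFunction Ω φ) (i : Fin n) :
    Integrable (fun x => u x * classicalGradient φ x i) (volume.restrict Ω) := by
  refine IsTestFunction.integrable_mul hu hφ.2.1 hφ.2.2 ?_ ?_
  · exact (hφ.1.continuous_fderiv (by simp)).clm_apply continuous_const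
  · intro x hx
    have : fderiv ℝ φ x = 0 := by
      by_contra h
      exact hx (support_fderiv_subset ℝ h)
    simp [classicalGradient, this]

theorem IsTestFunction.integrable_field_mul {Ω : Set (EuclideanSpace ℝ (Fin n))}
    (G : L2Field Ω) {φ : EuclideanSpace ℝ (Fin n) → ℂ}
    (hφ : IsTestFunction Ω φ) (i : Fin n) :
    Integrable (fun x => G x i * φ x) (volume.restrict Ω) := by
  refine IsTestFunction.integrable_mul (isL2Loc_of_memLp ?_) hφ.2.1 hφ.2.2 hφ.1.continuous
    (fun x hx => image_eq_zero_of_notMem_tsupport hx)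
  exact (EuclideanSpace.proj (𝕜 := ℂ) i).comp_memLp' (Lp.memLp G)

theorem IsBeppoLevi.zero {Ω : Set (EuclideanSpace ℝ (Fin n))} : IsBeppoLevi Ω 0 := by
  refine ⟨fun _ _ _ => MemLp.zero, 0, fun φ _ i => ?_⟩
  have h : (fun x => ((0 : L2Field Ω) : EuclideanSpace ℝ (Fin n) → EuclideanSpace ℂ (Fin n)) x i
      * φ x) =ᵐ[volume.restrict Ω] 0 := by
    filter_upwards [Lp.coeFn_zero (EuclideanSpace ℂ (Fin n)) 2 (volume.restrict Ω)] with x hx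
    rw [hx]
    simp
  rw [integral_congr_ae h]
  simp

theorem IsBeppoLevi.add {Ω : Set (EuclideanSpace ℝ (Fin n))}
    {u v : EuclideanSpace ℝ (Fin n) → ℂ} (hu : IsBeppoLevi Ω u) (hv : IsBeppoLevi Ω v) :
    IsBeppoLevi Ω (u + v) := by
  obtain ⟨hu, G, hG⟩ := hu
  obtain ⟨hv, F, hF⟩ := hv
  refine ⟨fun K hK hKΩ => (hu K hK hKΩ).add (hv K hK hKΩ), G + F, fun φ hφ i => ?_⟩
  have h : (fun x => (G + F : L2Field Ω) x i * φ x)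
      =ᵐ[volume.restrict Ω] fun x => G x i * φ x + F x i * φ x := by
    filter_upwards [Lp.coeFn_add G F] with x hx
    rw [hx, Pi.add_apply, PiLp.add_apply, add_mul]
  rw [integral_congr_ae h, integral_add (hφ.integrable_field_mul G i) (hφ.integrable_field_mul F i),
    neg_add, ← hG φ hφ i, ← hF φ hφ i,
    ← integral_add (hφ.integrable_mul_classicalGradient hu i)
      (hφ.integrable_mul_classicalGradient hv i)]
  simp [add_mul]

theorem IsBeppoLevi.const_smul {Ω : Set (EuclideanSpace ℝ (Fin n))}
    {u : EuclideanSpace ℝ (Fin n) → ℂ} (c : ℂ) (hu : IsBeppoLevi Ω u) :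
    IsBeppoLevi Ω (c • u) := by
  obtain ⟨hu, G, hG⟩ := hu
  refine ⟨fun K hK hKΩ => (hu K hK hKΩ).const_smul c, c • G, fun φ hφ i => ?_⟩
  have h : (fun x => (c • G : L2Field Ω) x i * φ x)
      =ᵐ[volume.restrict Ω] fun x => c * (G x i * φ x) := by
    filter_upwards [Lp.coeFn_smul c G] with x hx
    simp [hx, mul_assoc]
  rw [integral_congr_ae h, integral_const_mul, ← mul_neg, ← hG φ hφ i, ← integral_const_mul]
  simp [mul_assoc]

/-- `H¹(Ω, m) = BL(Ω) ∩ L²(Ω, m)`, as a subspace of `L²(Ω, m)`, for a measure `m` on `Ω`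
with the same null sets as `dx`. -/
def sobolevH1 (Ω : Set (EuclideanSpace ℝ (Fin n))) (m : Measure (EuclideanSpace ℝ (Fin n))) :
    Submodule ℂ (Lp ℂ 2 m) where
  carrier := {u | ∃ f, IsBeppoLevi Ω f ∧ u =ᵐ[m] f}
  zero_mem' := ⟨0, IsBeppoLevi.zero, Lp.coeFn_zero ℂ 2 m⟩
  add_mem' := by
    rintro u v ⟨f, hf, huf⟩ ⟨g, hg, hvg⟩
    exact ⟨f + g, hf.add hg, (Lp.coeFn_add u v).trans (huf.add hvg)⟩
  smul_mem' := by
    rintro c u ⟨f, hf, huf⟩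
    exact ⟨c • f, hf.const_smul c, (Lp.coeFn_smul c u).trans (huf.const_smul c)⟩

open Classical in
/-- The weak gradient `∇u ∈ L²(Ω, dx; ℂⁿ)` of a Beppo Levi function (and `0` if `u` has none); it is
unique as an element of `L²`. -/
def weakGradient (Ω : Set (EuclideanSpace ℝ (Fin n))) (u : EuclideanSpace ℝ (Fin n) → ℂ) :
    L2Field Ω :=
  if h : ∃ G : L2Field Ω, IsWeakGradient Ω u G then h.choose else 0

/-- The Dirichlet integral `𝓓_Ω(u, v) = ∫_Ω ⟪∇u, ∇v⟫ dx`. -/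
def dirichletIntegral (Ω : Set (EuclideanSpace ℝ (Fin n)))
    (u v : EuclideanSpace ℝ (Fin n) → ℂ) : ℂ :=
  ∫ x in Ω, ⟪weakGradient Ω u x, weakGradient Ω v x⟫_ℂ

/-- The Dirichlet integral `(𝓓_Ω, H¹(Ω, m))` as a form on `L²(Ω, m)`. -/
def dirichletForm (Ω : Set (EuclideanSpace ℝ (Fin n))) (m : Measure (EuclideanSpace ℝ (Fin n))) :
    HilbertForm (Lp ℂ 2 m) where
  domain := sobolevH1 Ω m
  toFun u v := dirichletIntegral Ω u v

/-- The pairs `(φ, ∇φ)`, `φ ∈ C_c^∞(Ω)`, in `L²(Ω, dx) × L²(Ω, dx; ℂⁿ)`. -/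
def testGradientGraph (Ω : Set (EuclideanSpace ℝ (Fin n))) :
    Submodule ℂ (Lp ℂ 2 (volume.restrict Ω) × L2Field Ω) where
  carrier := {p | ∃ φ, IsTestFunction Ω φ ∧ p.1 =ᵐ[volume.restrict Ω] φ ∧
    p.2 =ᵐ[volume.restrict Ω] classicalGradient φ}
  zero_mem' := ⟨0, IsTestFunction.zero, Lp.coeFn_zero _ _ _,
    by rw [classicalGradient_zero]; exact Lp.coeFn_zero _ _ _⟩
  add_mem' := by
    rintro p q ⟨φ, hφ, hp, hp'⟩ ⟨ψ, hψ, hq, hq'⟩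
    refine ⟨φ + ψ, hφ.add hψ, (Lp.coeFn_add _ _).trans (hp.add hq), ?_⟩
    rw [classicalGradient_add hφ.1 hψ.1]
    exact (Lp.coeFn_add _ _).trans (hp'.add hq')
  smul_mem' := by
    rintro c p ⟨φ, hφ, hp, hp'⟩
    refine ⟨c • φ, hφ.const_smul c, (Lp.coeFn_smul _ _).trans (hp.const_smul c), ?_⟩
    rw [classicalGradient_smul c hφ.1]
    exact (Lp.coeFn_smul _ _).trans (hp'.const_smul c)

/-- `H¹₀(Ω, dx)`: the closure of `C_c^∞(Ω)` in the norm `(‖u‖² + ‖∇u‖²)^{1/2}`, as a subspace of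
`L²(Ω, dx)`. An `L²`-function belongs to it if and only if it is the first component of a limit of
pairs `(φ, ∇φ)` (the second component is then its weak gradient). -/
def sobolevH10 (Ω : Set (EuclideanSpace ℝ (Fin n))) :
    Submodule ℂ (Lp ℂ 2 (volume.restrict Ω)) :=
  (testGradientGraph Ω).topologicalClosure.map (LinearMap.fst ℂ _ _)

/-! ### Schrödinger forms with Kato-class potentials -/

/-- The Kato class `K_n(Ω, dx)` in dimension `n ≥ 3`:
`sup_{x ∈ ℝⁿ} ∫_{Ω ∩ B(x, α)} |x - y|^{2 - n} |V(y)| dy → 0` as `α ↓ 0`. -/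
def IsKatoClass (Ω : Set (EuclideanSpace ℝ (Fin n))) (V : EuclideanSpace ℝ (Fin n) → ℝ) : Prop :=
  AEMeasurable V (volume.restrict Ω) ∧
  Tendsto (fun α : ℝ => ⨆ x : EuclideanSpace ℝ (Fin n),
    ∫⁻ y in Ω ∩ Metric.ball x α, ENNReal.ofReal (‖x - y‖ ^ (2 - (n : ℝ)) * |V y|))
    (𝓝[>] 0) (𝓝 0)

/-- The form `𝓠_V(u, v) = 𝓓_Ω(u, v) + ∫_Ω V ū v dx` on `H¹₀(Ω, dx)` of the Schrödinger operator
`-Δ + V`; thus `𝓠_V[u] = 𝓓_Ω[u] + ∫_Ω |u|² V dx`. -/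
def schrodingerForm (Ω : Set (EuclideanSpace ℝ (Fin n))) (V : EuclideanSpace ℝ (Fin n) → ℝ) :
    HilbertForm (Lp ℂ 2 (volume.restrict Ω)) where
  domain := sobolevH10 Ω
  toFun u v := dirichletIntegral Ω u v + ∫ x in Ω, (V x : ℂ) * ⟪u x, v x⟫_ℂ

/-- The sublevel set `U_e = {x ∈ Ω : V(x) < e}`. -/
def sublevelSet (Ω : Set (EuclideanSpace ℝ (Fin n))) (V : EuclideanSpace ℝ (Fin n) → ℝ) (e : ℝ) :
    Set (EuclideanSpace ℝ (Fin n)) :=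
  {x ∈ Ω | V x < e}

/-- The weighted Lebesgue measure `m_e(dx) = (V - e)₋ dx` on `U_e`. -/
def sublevelMeasure (Ω : Set (EuclideanSpace ℝ (Fin n))) (V : EuclideanSpace ℝ (Fin n) → ℝ)
    (e : ℝ) : Measure (EuclideanSpace ℝ (Fin n)) :=
  (volume.restrict (sublevelSet Ω V e)).withDensity fun x => ENNReal.ofReal (V x - e)⁻

end Sobolev

end

/-! The argument is a variational comparison. If `u` lies in a spectral subspace of `-Δ + V` for
`(a, e]`, then `𝓠_V[u] ≤ e‖u‖²`, that is `∫_Ω |∇u|² ≤ ∫_Ω (e - V)|u|²`. Outside `U_e` the factor `e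
- V` is nonpositive, so the right side is at most `∫_{U_e} |u|² dm_e`. Hence the restriction of `u`
to `U_e` lies in `H¹(U_e, m_e)` and satisfies `𝓓_{U_e}[u] ≤ ‖u‖²_{m_e} ≤ λ‖u‖²_{m_e}`. The
restriction is injective: if `u = 0` on `U_e`, the same chain gives `∇u = 0` on all of `Ω`, and the
Sobolev inequality on `H¹₀` (here `n ≥ 3`) gives `u = 0`. Finally, `E((-∞, λ])` of the Dirichlet
operator is injective on the restrictions, because `𝓓[v] > λ‖v‖²` for every nonzero form-domain
vector `v` which it kills. This bounds the dimension.

The energy estimate is carried by `integrable_and_gradient_le` and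
`integrable_sublevelMeasure_and_integral`, injectivity by
`eq_zero_of_mem_closure_of_gradient_eq_zero`, and the comparison of dimensions by
`HilbertForm.countingFunction_le`.

`countingFunction` takes the value `0` for a form without a spectral measure, so existence must be
proved for the form on the right (and only there). The Dirichlet form is closed and densely defined.
Upper semicontinuity makes `U_e` open and bounds `dx` by a multiple of `m_e` on compact sets, so
weak gradients survive limits in `L²(m_e)`. The Kato condition makes `m_e` finite on compact sets,
so test functions belong to the domain. For a closed form, `T = (1 + L)⁻¹` is a bounded self-adjoint
operator. Its continuous functional calculus is extended to indicators of Borel sets, and the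
resulting projections are transported by `t ↦ 1/t - 1`. -/

noncomputable section

/-! ### The Borel functional calculus of a representation of `C(X, ℝ)` -/

section BorelCalculus

set_option linter.unusedSectionVars false

variable {H : Type*} [NormedAddCommGroup H] [InnerProductSpace ℂ H] [CompleteSpace H]
  {X : Type*} [MetricSpace X] [CompactSpace X] [MeasurableSpace X] [BorelSpace X]
  (Φ : C(X, ℝ) →⋆ₐ[ℝ] (H →L[ℂ] H))

theorem starAlgHom_inner_left (f : C(X, ℝ)) (x y : H) : ⟪Φ f x, y⟫_ℂ = ⟪x, Φ f y⟫_ℂ := by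
  have h : ContinuousLinearMap.adjoint (Φ f) = Φ f := by
    rw [← ContinuousLinearMap.star_eq_adjoint, ← map_star, star_trivial]
  conv_lhs => rw [← h]
  exact ContinuousLinearMap.adjoint_inner_left _ _ _

theorem starAlgHom_mul_apply (f g : C(X, ℝ)) (x : H) : Φ (f * g) x = Φ f (Φ g x) := by
  rw [map_mul]; rfl

theorem re_inner_starAlgHom_sq (f : C(X, ℝ)) (x : H) :
    (⟪x, Φ (f * f) x⟫_ℂ).re = ‖Φ f x‖ ^ 2 := by
  rw [starAlgHom_mul_apply, ← starAlgHom_inner_left, inner_self_eq_norm_sq_to_K]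
  norm_cast

/-- With `g = √f`, the value is `‖Φ(g) x‖²`. This positivity is what the Riesz representation
theorem needs. -/
theorem re_inner_starAlgHom_nonneg {f : C(X, ℝ)} (hf : ∀ t, 0 ≤ f t) (x : H) :
    0 ≤ (⟪x, Φ f x⟫_ℂ).re := by
  let g : C(X, ℝ) := ⟨fun t => Real.sqrt (f t), f.continuous.sqrt⟩
  have h : g * g = f := by ext t; exact Real.mul_self_sqrt (hf t)
  rw [← h, re_inner_starAlgHom_sq]
  positivity

/-- The positive functional `f ↦ ⟪x, Φ(f) x⟫`. -/
def starAlgHomFunctional (x : H) : CompactlySupportedContinuousMap X ℝ →ₚ[ℝ] ℝ :=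
  PositiveLinearMap.mk₀
    { toFun := fun f => (⟪x, Φ f.toContinuousMap x⟫_ℂ).re
      map_add' := fun f g => by
        have h : (f + g).toContinuousMap = f.toContinuousMap + g.toContinuousMap := rfl
        rw [h, map_add, add_apply, inner_add_right, Complex.add_re]
      map_smul' := fun c f => by
        have h : (c • f).toContinuousMap = c • f.toContinuousMap := rfl
        rw [h, map_smul, smul_apply, RCLike.real_smul_eq_coe_smul (K := ℂ),
          inner_smul_right]
        simp }
    (fun f hf => re_inner_starAlgHom_nonneg Φ (fun t => hf t) x)

/-- The measure `μ_x` with `⟪x, Φ(f) x⟫ = ∫ f dμ_x`. -/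
def cyclicMeasure (x : H) : Measure X := RealRMK.rieszMeasure (starAlgHomFunctional Φ x)

instance (x : H) : IsFiniteMeasure (cyclicMeasure Φ x) := by
  have : (cyclicMeasure Φ x).Regular := RealRMK.regular_rieszMeasure _
  infer_instance

theorem integral_cyclicMeasure (x : H) (f : C(X, ℝ)) :
    ∫ t, f t ∂(cyclicMeasure Φ x) = (⟪x, Φ f x⟫_ℂ).re :=
  RealRMK.integral_rieszMeasure (starAlgHomFunctional Φ x)
    (CompactlySupportedContinuousMap.continuousMapEquiv f)

theorem inner_starAlgHom_self (x : H) (f : C(X, ℝ)) :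
    ⟪x, Φ f x⟫_ℂ = ((∫ t, f t ∂(cyclicMeasure Φ x) : ℝ) : ℂ) := by
  refine Complex.ext (integral_cyclicMeasure Φ x f).symm ?_
  rw [Complex.ofReal_im]
  refine Complex.conj_eq_iff_im.1 ?_
  rw [inner_conj_symm, starAlgHom_inner_left]

theorem ext_of_forall_integral_continuousMap {μ ν : Measure X} [IsFiniteMeasure μ]
    [IsFiniteMeasure ν] (h : ∀ f : C(X, ℝ), ∫ t, f t ∂μ = ∫ t, f t ∂ν) : μ = ν :=
  ext_of_forall_integral_eq_of_IsFiniteMeasure fun f => h f.toContinuousMap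

/-- Both squares equal `⟪x, Φ(f²) x⟫ = ∫ f² dμ_x`. Hence `f ↦ Φ(f) x` extends isometrically from
continuous functions to `L²(μ_x)`. -/
theorem norm_toLp_cyclicMeasure (x : H) (f : C(X, ℝ)) :
    ‖ContinuousMap.toLp (E := ℝ) 2 (cyclicMeasure Φ x) ℝ f‖ = ‖Φ f x‖ := by
  have h : ‖ContinuousMap.toLp (E := ℝ) 2 (cyclicMeasure Φ x) ℝ f‖ ^ 2 = ‖Φ f x‖ ^ 2 := by
    rw [← real_inner_self_eq_norm_sq, L2.inner_def, ← re_inner_starAlgHom_sq,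
      ← integral_cyclicMeasure]
    refine integral_congr_ae ?_
    filter_upwards [ContinuousMap.coeFn_toLp (𝕜 := ℝ) (p := 2) (cyclicMeasure Φ x) f] with t ht
    rw [ht]
    simp [sq]
  exact (sq_eq_sq₀ (norm_nonneg _) (norm_nonneg _)).1 h

/-- The map `f ↦ Φ(f) x`. -/
def orbitMap (x : H) : C(X, ℝ) →ₗ[ℝ] H where
  toFun f := Φ f x
  map_add' f g := by rw [map_add]; rfl
  map_smul' c f := by rw [map_smul]; rfl

/-- The isometry `L²(μ_x) → H` that maps a continuous function `f` to `Φ(f) x`. -/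
def cyclicMap (x : H) : Lp ℝ 2 (cyclicMeasure Φ x) →L[ℝ] H :=
  (orbitMap Φ x).extendOfNorm (ContinuousMap.toLp (E := ℝ) 2 (cyclicMeasure Φ x) ℝ).toLinearMap

theorem cyclicMap_toLp (x : H) (f : C(X, ℝ)) :
    cyclicMap Φ x (ContinuousMap.toLp (E := ℝ) 2 (cyclicMeasure Φ x) ℝ f) = Φ f x := by
  have hd : DenseRange (ContinuousMap.toLp (E := ℝ) 2 (cyclicMeasure Φ x) ℝ).toLinearMap :=
    ContinuousMap.toLp_denseRange ℝ _ ℝ (by norm_num)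
  have h1 : ∀ f : C(X, ℝ), ‖orbitMap Φ x f‖ ≤
      1 * ‖(ContinuousMap.toLp (E := ℝ) 2 (cyclicMeasure Φ x) ℝ).toLinearMap f‖ := fun f => by
    rw [one_mul]; exact (norm_toLp_cyclicMeasure Φ x f).ge
  exact LinearMap.extendOfNorm_eq hd ⟨1, h1⟩ f

theorem norm_cyclicMap (x : H) (g : Lp ℝ 2 (cyclicMeasure Φ x)) : ‖cyclicMap Φ x g‖ = ‖g‖ := by
  have hd : DenseRange (ContinuousMap.toLp (E := ℝ) 2 (cyclicMeasure Φ x) ℝ) :=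
    ContinuousMap.toLp_denseRange ℝ _ ℝ (by norm_num)
  refine congrFun (hd.equalizer (cyclicMap Φ x).continuous.norm continuous_norm ?_) g
  ext f
  simp only [Function.comp_apply]
  rw [cyclicMap_toLp, norm_toLp_cyclicMeasure]

open Classical in
/-- `g(Φ) x`, for a function `g` in `L²(μ_x)`. -/
def borelApply (g : X → ℝ) (x : H) : H :=
  if h : MemLp g 2 (cyclicMeasure Φ x) then cyclicMap Φ x h.toLp else 0

variable {Φ}

theorem borelApply_of_memLp {g : X → ℝ} {x : H} (h : MemLp g 2 (cyclicMeasure Φ x)) :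
    borelApply Φ g x = cyclicMap Φ x h.toLp := dif_pos h

theorem norm_borelApply_sq {g : X → ℝ} {x : H} (h : MemLp g 2 (cyclicMeasure Φ x)) :
    ‖borelApply Φ g x‖ ^ 2 = ∫ t, g t ^ 2 ∂(cyclicMeasure Φ x) := by
  rw [borelApply_of_memLp h, norm_cyclicMap, ← real_inner_self_eq_norm_sq, L2.inner_def]
  refine integral_congr_ae ?_
  filter_upwards [h.coeFn_toLp] with t ht
  rw [ht]
  simp [sq]

theorem borelApply_congr {g g' : X → ℝ} {x : H} (h : g =ᵐ[cyclicMeasure Φ x] g') :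
    borelApply Φ g x = borelApply Φ g' x := by
  by_cases hg : MemLp g 2 (cyclicMeasure Φ x)
  · have hg' := (memLp_congr_ae h).1 hg
    rw [borelApply_of_memLp hg, borelApply_of_memLp hg', (MemLp.toLp_eq_toLp_iff hg hg').2 h]
  · have hg' := fun h' => hg ((memLp_congr_ae h).2 h')
    rw [borelApply, borelApply, dif_neg hg, dif_neg hg']

theorem memLp_continuousMap (f : C(X, ℝ)) (p : ℝ≥0∞) (μ : Measure X) [IsFiniteMeasure μ] :
    MemLp f p μ :=
  MemLp.of_bound f.continuous.aestronglyMeasurable ‖f‖ (.of_forall fun t => f.norm_coe_le_norm t)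

theorem borelApply_continuousMap (f : C(X, ℝ)) (x : H) : borelApply Φ f x = Φ f x := by
  rw [borelApply_of_memLp (memLp_continuousMap f 2 _), ← cyclicMap_toLp]
  congr 1

theorem tendsto_borelApply {g : X → ℝ} {f : ℕ → X → ℝ} {x : H}
    (hg : MemLp g 2 (cyclicMeasure Φ x)) (hf : ∀ k, MemLp (f k) 2 (cyclicMeasure Φ x))
    (h : Tendsto (fun k => eLpNorm (f k - g) 2 (cyclicMeasure Φ x)) atTop (𝓝 0)) :
    Tendsto (fun k => borelApply Φ (f k) x) atTop (𝓝 (borelApply Φ g x)) := by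
  have h1 : Tendsto (fun k => (hf k).toLp (f k)) atTop (𝓝 hg.toLp) :=
    (Lp.tendsto_Lp_iff_tendsto_eLpNorm'' _ _ _ _).2 h
  rw [borelApply_of_memLp hg]
  simp only [fun k => borelApply_of_memLp (hf k)]
  exact ((cyclicMap Φ x).continuous.tendsto _).comp h1

theorem exists_seq_continuousMap_tendsto {g : X → ℝ} {ν : Measure X} [IsFiniteMeasure ν]
    (hg : MemLp g 2 ν) :
    ∃ f : ℕ → C(X, ℝ), Tendsto (fun k => eLpNorm (⇑(f k) - g) 2 ν) atTop (𝓝 0) := by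
  have h : ∀ k : ℕ, ∃ f : C(X, ℝ), eLpNorm (⇑f - g) 2 ν ≤ ENNReal.ofReal (1 / ((k : ℝ) + 1)) := by
    intro k
    obtain ⟨f, hf, -⟩ := hg.exists_boundedContinuous_eLpNorm_sub_le (by norm_num)
      (ε := ENNReal.ofReal (1 / ((k : ℝ) + 1))) (by simp; positivity)
    refine ⟨f.toContinuousMap, ?_⟩
    rw [← eLpNorm_neg, neg_sub]
    exact hf
  choose f hf using h
  refine ⟨f, tendsto_of_tendsto_of_tendsto_of_le_of_le tendsto_const_nhds ?_
    (fun _ => zero_le) hf⟩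
  simpa using ENNReal.tendsto_ofReal tendsto_one_div_add_atTop_nhds_zero_nat

/-- Allowing any `ν ≥ μ_x` lets one approximating sequence serve several vectors at once: take for
`ν` the sum of their measures. Additivity, homogeneity and symmetry in the vector then pass to the
limit from continuous functions. -/
theorem tendsto_starAlgHom_apply {g : X → ℝ} {f : ℕ → C(X, ℝ)} {x : H} {ν : Measure X}
    (hν : cyclicMeasure Φ x ≤ ν) (hg : MemLp g 2 ν)
    (h : Tendsto (fun k => eLpNorm (⇑(f k) - g) 2 ν) atTop (𝓝 0)) :
    Tendsto (fun k => Φ (f k) x) atTop (𝓝 (borelApply Φ g x)) := by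
  have h1 := tendsto_borelApply (Φ := Φ) (x := x) (f := fun k => f k) (hg.mono_measure hν)
    (fun k => memLp_continuousMap _ _ _)
    (tendsto_of_tendsto_of_tendsto_of_le_of_le tendsto_const_nhds h (fun _ => zero_le)
      fun k => eLpNorm_mono_measure _ hν)
  simpa only [borelApply_continuousMap] using h1

theorem memLp_two_add_measure {g : X → ℝ} {μ ν : Measure X} (hμ : MemLp g 2 μ)
    (hν : MemLp g 2 ν) : MemLp g 2 (μ + ν) :=
  (memLp_two_iff_integrable_sq (hμ.1.add_measure hν.1)).2
    (hμ.integrable_sq.add_measure hν.integrable_sq)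

theorem borelApply_add {g : X → ℝ} (x y : H) (hx : MemLp g 2 (cyclicMeasure Φ x))
    (hy : MemLp g 2 (cyclicMeasure Φ y)) (hxy : MemLp g 2 (cyclicMeasure Φ (x + y))) :
    borelApply Φ g (x + y) = borelApply Φ g x + borelApply Φ g y := by
  have hg := memLp_two_add_measure (memLp_two_add_measure hx hy) hxy
  obtain ⟨f, hf⟩ := exists_seq_continuousMap_tendsto hg
  have h1 := tendsto_starAlgHom_apply (x := x) (Measure.le_add_right (Measure.le_add_right le_rfl))
    hg hf
  have h2 := tendsto_starAlgHom_apply (x := y) (Measure.le_add_right (Measure.le_add_left le_rfl))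
    hg hf
  have h3 := tendsto_starAlgHom_apply (x := x + y) (Measure.le_add_left le_rfl) hg hf
  refine tendsto_nhds_unique h3 ?_
  simpa only [map_add] using h1.add h2

theorem borelApply_smul {g : X → ℝ} (c : ℂ) (x : H) (hx : MemLp g 2 (cyclicMeasure Φ x))
    (hcx : MemLp g 2 (cyclicMeasure Φ (c • x))) :
    borelApply Φ g (c • x) = c • borelApply Φ g x := by
  have hg := memLp_two_add_measure hx hcx
  obtain ⟨f, hf⟩ := exists_seq_continuousMap_tendsto hg
  have h1 := tendsto_starAlgHom_apply (x := x) (Measure.le_add_right le_rfl) hg hf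
  have h3 := tendsto_starAlgHom_apply (x := c • x) (Measure.le_add_left le_rfl) hg hf
  refine tendsto_nhds_unique h3 ?_
  simpa only [map_smul] using h1.const_smul c

theorem inner_borelApply_left {g : X → ℝ} (x y : H) (hx : MemLp g 2 (cyclicMeasure Φ x))
    (hy : MemLp g 2 (cyclicMeasure Φ y)) :
    ⟪borelApply Φ g x, y⟫_ℂ = ⟪x, borelApply Φ g y⟫_ℂ := by
  have hg := memLp_two_add_measure hx hy
  obtain ⟨f, hf⟩ := exists_seq_continuousMap_tendsto hg
  have h1 := tendsto_starAlgHom_apply (x := x) (Measure.le_add_right le_rfl) hg hf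
  have h2 := tendsto_starAlgHom_apply (x := y) (Measure.le_add_left le_rfl) hg hf
  refine tendsto_nhds_unique (h1.inner tendsto_const_nhds) ?_
  simp only [starAlgHom_inner_left]
  exact tendsto_const_nhds.inner h2

theorem re_inner_borelApply {g : X → ℝ} {x : H} (hx : MemLp g 2 (cyclicMeasure Φ x)) :
    (⟪x, borelApply Φ g x⟫_ℂ).re = ∫ t, g t ∂(cyclicMeasure Φ x) := by
  obtain ⟨f, hf⟩ := exists_seq_continuousMap_tendsto hx
  have h1 := tendsto_starAlgHom_apply (x := x) le_rfl hx hf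
  have h2 : Tendsto (fun k => (⟪x, Φ (f k) x⟫_ℂ).re) atTop (𝓝 (⟪x, borelApply Φ g x⟫_ℂ).re) :=
    (Complex.continuous_re.tendsto _).comp (tendsto_const_nhds.inner h1)
  refine tendsto_nhds_unique h2 ?_
  simp only [← integral_cyclicMeasure]
  refine tendsto_integral_of_L1' (l := atTop) (F := fun k t => f k t) g
    hx.1
    (.of_forall fun k => (memLp_continuousMap (f k) 1 _).integrable le_rfl) ?_
  -- Since `μ_x` is finite, convergence in `L²` implies convergence in `L¹`.
  have h3 : ∀ k, eLpNorm (⇑(f k) - g) 1 (cyclicMeasure Φ x) ≤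
      eLpNorm (⇑(f k) - g) 2 (cyclicMeasure Φ x) *
        (cyclicMeasure Φ x univ) ^ (1 / (1 : ℝ≥0∞).toReal - 1 / (2 : ℝ≥0∞).toReal) := fun k =>
    eLpNorm_le_eLpNorm_mul_rpow_measure_univ (by norm_num)
      ((memLp_continuousMap (f k) 2 _).sub hx).1
  refine tendsto_of_tendsto_of_tendsto_of_le_of_le tendsto_const_nhds ?_ (fun _ => zero_le) h3
  have := ENNReal.Tendsto.mul_const (b := (cyclicMeasure Φ x univ) ^
    (1 / (1 : ℝ≥0∞).toReal - 1 / (2 : ℝ≥0∞).toReal)) hf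
    (.inr (ENNReal.rpow_ne_top_of_nonneg (by norm_num) (measure_ne_top _ _)))
  simpa using this

theorem starAlgHom_borelApply {g : X → ℝ} {x : H} (f : C(X, ℝ))
    (hg : MemLp g 2 (cyclicMeasure Φ x)) :
    Φ f (borelApply Φ g x) = borelApply Φ (fun t => f t * g t) x := by
  have hfg : MemLp (fun t => f t * g t) 2 (cyclicMeasure Φ x) :=
    hg.mul' (memLp_continuousMap f ∞ _)
  obtain ⟨h, hh⟩ := exists_seq_continuousMap_tendsto hg
  have h1 := ((Φ f).continuous.tendsto _).comp (tendsto_starAlgHom_apply (x := x) le_rfl hg hh)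
  simp only [Function.comp_def] at h1
  refine tendsto_nhds_unique h1 ?_
  have h2 := tendsto_starAlgHom_apply (x := x) (f := fun k => f * h k) le_rfl hfg ?_
  · simpa only [starAlgHom_mul_apply] using h2
  have h3 : ∀ k, eLpNorm (⇑(f * h k) - fun t => f t * g t) 2 (cyclicMeasure Φ x) ≤
      ENNReal.ofReal ‖f‖ * eLpNorm (⇑(h k) - g) 2 (cyclicMeasure Φ x) := fun k => by
    refine eLpNorm_le_mul_eLpNorm_of_ae_le_mul (.of_forall fun t => ?_) _
    simp only [Pi.sub_apply, ContinuousMap.mul_apply, ← mul_sub, norm_mul]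
    gcongr
    exact f.norm_coe_le_norm t
  refine tendsto_of_tendsto_of_tendsto_of_le_of_le tendsto_const_nhds ?_ (fun _ => zero_le) h3
  simpa using ENNReal.Tendsto.const_mul (a := ENNReal.ofReal ‖f‖) hh (.inr ENNReal.ofReal_ne_top)

/-- For continuous `h`, `⟪Φ(f)x, Φ(h)Φ(f)x⟫ = ⟪x, Φ(f²h)x⟫ = ∫ h f² dμ_x`, and continuous functions
determine a finite measure. -/
theorem cyclicMeasure_starAlgHom_apply (f : C(X, ℝ)) (x : H) :
    cyclicMeasure Φ (Φ f x) =
      (cyclicMeasure Φ x).withDensity fun t => ENNReal.ofReal (f t ^ 2) := by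
  have hf : Measurable fun t => (f t ^ 2).toNNReal := by
    have := f.continuous.measurable
    fun_prop
  have hi : Integrable (fun t => f t ^ 2) (cyclicMeasure Φ x) :=
    (memLp_continuousMap f 2 _).integrable_sq
  have : IsFiniteMeasure ((cyclicMeasure Φ x).withDensity fun t => ENNReal.ofReal (f t ^ 2)) :=
    isFiniteMeasure_withDensity_ofReal hi.2
  refine ext_of_forall_integral_continuousMap fun h => ?_
  rw [integral_cyclicMeasure, starAlgHom_inner_left, ← starAlgHom_mul_apply,
    ← starAlgHom_mul_apply, ← integral_cyclicMeasure]
  refine Eq.trans ?_ (integral_withDensity_eq_integral_smul hf _).symm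
  refine integral_congr_ae (.of_forall fun t => ?_)
  simp only [ContinuousMap.mul_apply, NNReal.smul_def, Real.coe_toNNReal _ (sq_nonneg (f t)),
    smul_eq_mul]
  ring

/-! ### The projections -/

theorem memLp_indicator_one {B : Set X} (hB : MeasurableSet B) (μ : Measure X)
    [IsFiniteMeasure μ] : MemLp (B.indicator fun _ => (1 : ℝ)) 2 μ :=
  (memLp_const 1).indicator hB

theorem norm_borelApply_indicator_sq {B : Set X} (hB : MeasurableSet B) (x : H) :
    ‖borelApply Φ (B.indicator fun _ => 1) x‖ ^ 2 = (cyclicMeasure Φ x).real B := by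
  rw [norm_borelApply_sq (memLp_indicator_one hB _), ← integral_indicator_one hB]
  refine integral_congr_ae (.of_forall fun t => ?_)
  by_cases ht : t ∈ B <;> simp [ht]

theorem cyclicMeasure_univ (x : H) : (cyclicMeasure Φ x).real univ = ‖x‖ ^ 2 := by
  have h := norm_borelApply_indicator_sq (Φ := Φ) MeasurableSet.univ x
  have h1 : ((univ : Set X).indicator fun _ => (1 : ℝ)) = ⇑(1 : C(X, ℝ)) := by ext; simp
  rw [h1, borelApply_continuousMap, map_one] at h
  exact h.symm

variable (Φ) in
open Classical in
/-- The spectral projection of a Borel subset of `X`. -/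
def borelProjection (B : Set X) : H →L[ℂ] H :=
  if hB : MeasurableSet B then
    LinearMap.mkContinuous
      { toFun := borelApply Φ (B.indicator fun _ => 1)
        map_add' := fun x y => borelApply_add x y (memLp_indicator_one hB _)
          (memLp_indicator_one hB _) (memLp_indicator_one hB _)
        map_smul' := fun c x => borelApply_smul c x (memLp_indicator_one hB _)
          (memLp_indicator_one hB _) } 1 (fun x => by
        rw [one_mul]
        refine (sq_le_sq₀ (norm_nonneg _) (norm_nonneg _)).1 ?_
        rw [← cyclicMeasure_univ (Φ := Φ) x]
        exact (norm_borelApply_indicator_sq hB x).trans_le (measureReal_mono (subset_univ _)))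
  else 0

theorem borelProjection_apply {B : Set X} (hB : MeasurableSet B) (x : H) :
    borelProjection Φ B x = borelApply Φ (B.indicator fun _ => 1) x := by
  rw [borelProjection, dif_pos hB]; rfl

theorem norm_borelProjection_sq {B : Set X} (hB : MeasurableSet B) (x : H) :
    ‖borelProjection Φ B x‖ ^ 2 = (cyclicMeasure Φ x).real B := by
  rw [borelProjection_apply hB, norm_borelApply_indicator_sq hB]

theorem adjoint_borelProjection {B : Set X} (hB : MeasurableSet B) :
    ContinuousLinearMap.adjoint (borelProjection Φ B) = borelProjection Φ B := by
  refine (ContinuousLinearMap.eq_adjoint_iff _ _).2 (fun x y => ?_) |>.symm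
  rw [borelProjection_apply hB, borelProjection_apply hB]
  exact inner_borelApply_left x y (memLp_indicator_one hB _) (memLp_indicator_one hB _)

/-- Idempotence needs no multiplicativity of the Borel calculus. On a complex space an operator is
determined by its diagonal, and `⟪P²x, x⟫ = ‖Px‖² = μ_x(B) = ⟪Px, x⟫`. -/
theorem isStarProjection_borelProjection {B : Set X} (hB : MeasurableSet B) :
    IsStarProjection (borelProjection Φ B) := by
  refine ⟨?_, adjoint_borelProjection hB⟩
  have hadj : ∀ x y : H, ⟪borelProjection Φ B x, y⟫_ℂ = ⟪x, borelProjection Φ B y⟫_ℂ := by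
    intro x y
    conv_lhs => rw [← adjoint_borelProjection hB]
    exact ContinuousLinearMap.adjoint_inner_left _ _ _
  have hreal : ∀ x : H, ⟪borelProjection Φ B x, x⟫_ℂ = ((cyclicMeasure Φ x).real B : ℝ) := by
    intro x
    have h1 : (⟪x, borelProjection Φ B x⟫_ℂ).re = (cyclicMeasure Φ x).real B := by
      rw [borelProjection_apply hB, re_inner_borelApply (memLp_indicator_one hB _),
        ← integral_indicator_one hB]
      rfl
    rw [hadj]
    refine Complex.ext h1 ?_
    have h2 : (starRingEnd ℂ) ⟪x, borelProjection Φ B x⟫_ℂ = ⟪x, borelProjection Φ B x⟫_ℂ := by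
      rw [inner_conj_symm, hadj]
    rw [Complex.ofReal_im]
    exact Complex.conj_eq_iff_im.1 h2
  have h : ((borelProjection Φ B * borelProjection Φ B : H →L[ℂ] H) : H →ₗ[ℂ] H) =
      (borelProjection Φ B : H →ₗ[ℂ] H) := by
    refine (ext_inner_map _ _).1 fun x => ?_
    have h1 : ⟪borelProjection Φ B (borelProjection Φ B x), x⟫_ℂ = ⟪borelProjection Φ B x, x⟫_ℂ := by
      rw [hadj (borelProjection Φ B x), inner_self_eq_norm_sq_to_K, hreal,
        ← norm_borelProjection_sq hB]
      norm_cast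
    exact h1
  exact ContinuousLinearMap.coe_inj.1 h

theorem borelProjection_union {A B : Set X} (hA : MeasurableSet A) (hB : MeasurableSet B)
    (hd : Disjoint A B) (x : H) :
    borelProjection Φ (A ∪ B) x = borelProjection Φ A x + borelProjection Φ B x := by
  rw [borelProjection_apply hA, borelProjection_apply hB, borelProjection_apply (hA.union hB),
    borelApply_of_memLp (memLp_indicator_one hA _), borelApply_of_memLp (memLp_indicator_one hB _),
    borelApply_of_memLp (memLp_indicator_one (hA.union hB) _), ← map_add, ← MemLp.toLp_add]
  congr 2
  exact indicator_union_of_disjoint hd _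

theorem borelProjection_biUnion_finset {B : ℕ → Set X} (hB : ∀ i, MeasurableSet (B i))
    (hd : Pairwise fun i j => Disjoint (B i) (B j)) (s : Finset ℕ) (x : H) :
    borelProjection Φ (⋃ i ∈ s, B i) x = ∑ i ∈ s, borelProjection Φ (B i) x := by
  induction s using Finset.induction_on with
  | empty =>
    have h : ‖borelProjection Φ (∅ : Set X) x‖ ^ 2 = 0 := by
      rw [norm_borelProjection_sq MeasurableSet.empty, measureReal_empty]
    simpa using h
  | insert a s ha ih =>
    rw [Finset.sum_insert ha, ← ih, Finset.set_biUnion_insert]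
    refine borelProjection_union (hB a) (s.measurableSet_biUnion fun i _ => hB i) ?_ x
    rw [disjoint_iUnion₂_right]
    exact fun i hi => hd (fun h => ha (h ▸ hi))

/-- The squared distance from a partial sum to the limit is `μ_x` of the union minus the partial sum
of the `μ_x(B_i)`, so strong convergence reduces to countable additivity of `μ_x`. -/
theorem hasSum_borelProjection_iUnion {B : ℕ → Set X} (hB : ∀ i, MeasurableSet (B i))
    (hd : Pairwise fun i j => Disjoint (B i) (B j)) (x : H) :
    HasSum (fun i => borelProjection Φ (B i) x) (borelProjection Φ (⋃ i, B i) x) := by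
  have hU := MeasurableSet.iUnion hB
  have hm : HasSum (fun i => (cyclicMeasure Φ x).real (B i))
      ((cyclicMeasure Φ x).real (⋃ i, B i)) := by
    have h := ENNReal.hasSum_toReal (f := fun i => cyclicMeasure Φ x (B i)) (by
      rw [← measure_iUnion hd hB]; exact measure_ne_top _ _)
    rwa [← ENNReal.tsum_toReal_eq (fun i => measure_ne_top _ _), ← measure_iUnion hd hB] at h
  have hs : ∀ s : Finset ℕ, ‖(∑ i ∈ s, borelProjection Φ (B i) x) -
      borelProjection Φ (⋃ i, B i) x‖ ^ 2 =
        (cyclicMeasure Φ x).real (⋃ i, B i) - ∑ i ∈ s, (cyclicMeasure Φ x).real (B i) := by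
    intro s
    have hS : MeasurableSet (⋃ i ∈ s, B i) := s.measurableSet_biUnion fun i _ => hB i
    have hsub : (⋃ i ∈ s, B i) ⊆ ⋃ i, B i := iUnion₂_subset fun i _ => subset_iUnion B i
    have h1 := borelProjection_union (Φ := Φ) hS (hU.diff hS) disjoint_sdiff_right x
    rw [union_sdiff_cancel hsub, borelProjection_biUnion_finset hB hd] at h1
    rw [h1, sub_add_cancel_left, norm_neg, norm_borelProjection_sq (hU.diff hS),
      measureReal_sdiff hsub hS,
      measureReal_biUnion_finset (fun i _ j _ hij => hd hij) (fun i _ => hB i)]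
  rw [HasSum, tendsto_iff_norm_sub_tendsto_zero]
  have h2 : Tendsto (fun s : Finset ℕ => ‖(∑ i ∈ s, borelProjection Φ (B i) x) -
      borelProjection Φ (⋃ i, B i) x‖ ^ 2) atTop (𝓝 0) := by
    simp only [hs]
    have h3 := (tendsto_const_nhds (x := (cyclicMeasure Φ x).real (⋃ i, B i))).sub hm
    rw [sub_self] at h3
    exact h3
  simpa using h2.sqrt

end BorelCalculus

/-! ### Spectral measures of operators with a bounded inverse -/

section Resolvent

variable {H : Type*} [NormedAddCommGroup H] [InnerProductSpace ℂ H] [CompleteSpace H]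

/-- The function `t ↦ 1/t - 1`, which maps the spectrum of `(1 + L)⁻¹` to that of `L`. -/
def resolventInverse {s : Set ℝ} (t : s) : ℝ := (t : ℝ)⁻¹ - 1

theorem measurable_resolventInverse {s : Set ℝ} : Measurable (resolventInverse (s := s)) :=
  (measurable_subtype_coe.inv).sub_const 1

/-- The spectral measure of `T⁻¹ - 1`. -/
def resolventSpectralMeasure {T : H →L[ℂ] H} (hT : IsSelfAdjoint T) :
    ProjectionValuedMeasure H where
  proj B := borelProjection (cfcHom hT : C(spectrum ℝ T, ℝ) →⋆ₐ[ℝ] (H →L[ℂ] H))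
    (resolventInverse ⁻¹' B)
  isStarProjection B hB := isStarProjection_borelProjection (measurable_resolventInverse hB)
  proj_univ := by
    ext x
    rw [borelProjection_apply (measurable_resolventInverse MeasurableSet.univ)]
    have h1 : ((resolventInverse ⁻¹' univ : Set (spectrum ℝ T)).indicator fun _ => (1 : ℝ)) =
      ⇑(1 : C(spectrum ℝ T, ℝ)) := by ext; simp
    rw [h1, borelApply_continuousMap, map_one]
  hasSum_iUnion B hB hd x := by
    rw [preimage_iUnion]
    exact hasSum_borelProjection_iUnion (fun i => measurable_resolventInverse (hB i))
      (fun i j hij => (hd hij).preimage _) x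

theorem ProjectionValuedMeasure.scalarMeasure_apply (E : ProjectionValuedMeasure H) (x : H)
    {B : Set ℝ} (hB : MeasurableSet B) :
    E.scalarMeasure x B = ENNReal.ofReal (‖E.proj B x‖ ^ 2) :=
  Measure.ofMeasurable_apply B hB

theorem scalarMeasure_resolventSpectralMeasure {T : H →L[ℂ] H} (hT : IsSelfAdjoint T) (x : H) :
    (resolventSpectralMeasure hT).scalarMeasure x =
      (cyclicMeasure (cfcHom hT : C(spectrum ℝ T, ℝ) →⋆ₐ[ℝ] (H →L[ℂ] H)) x).map
        resolventInverse := by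
  ext B hB
  rw [ProjectionValuedMeasure.scalarMeasure_apply _ _ hB,
    Measure.map_apply measurable_resolventInverse hB, ← ofReal_measureReal]
  congr 1
  exact norm_borelProjection_sq (measurable_resolventInverse hB) x

/-- The spectral projection of `{0}` maps into `ker T = 0`, since `t · 1_{0}(t)` vanishes
identically. This makes the value of `resolventInverse` at `0`, where it is `-1` by convention,
irrelevant. -/
theorem ae_cyclicMeasure_ne_zero {T : H →L[ℂ] H} (hT : IsSelfAdjoint T)
    (hinj : ∀ x, T x = 0 → x = 0) (x : H) :
    ∀ᵐ (t : spectrum ℝ T) ∂(cyclicMeasure (cfcHom hT : C(spectrum ℝ T, ℝ) →⋆ₐ[ℝ] (H →L[ℂ] H)) x),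
      (t : ℝ) ≠ 0 := by
  set Φ := (cfcHom hT : C(spectrum ℝ T, ℝ) →⋆ₐ[ℝ] (H →L[ℂ] H)) with hΦ
  let f : C(spectrum ℝ T, ℝ) := ContinuousMap.restrict (spectrum ℝ T) (ContinuousMap.id ℝ)
  have hf : Φ f = T := cfcHom_id hT
  have hB : MeasurableSet {t : spectrum ℝ T | (t : ℝ) = 0} :=
    measurable_subtype_coe (measurableSet_singleton 0)
  have h1 : Φ f (borelProjection Φ {t : spectrum ℝ T | (t : ℝ) = 0} x) = 0 := by
    rw [borelProjection_apply hB, starAlgHom_borelApply f (memLp_indicator_one hB _)]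
    have h2 : (fun t => f t * ({t : spectrum ℝ T | (t : ℝ) = 0}.indicator (fun _ => (1 : ℝ)) t)) =
        ⇑(0 : C(spectrum ℝ T, ℝ)) := by
      ext t
      by_cases ht : (t : ℝ) = 0
      · have : f t = 0 := ht
        simp [this]
      · simp [indicator, ht]
    rw [h2, borelApply_continuousMap, map_zero]
    rfl
  rw [hf] at h1
  have h2 := norm_borelProjection_sq (Φ := Φ) hB x
  rw [hinj _ h1, norm_zero, zero_pow two_ne_zero] at h2
  rw [ae_iff]
  simp only [ne_eq, not_not]
  exact (measureReal_eq_zero_iff (measure_ne_top _ _)).1 h2.symm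

/-- For `u ∈ D(L)` put `w = u + Lu`; then `u = Tw` and `μ_u = t² μ_w`. Integrals of `(1/t - 1)²` and
`1/t - 1` against `μ_u` become those of `(1 - t)²` and `t(1 - t)` against `μ_w`; the first is finite
and the second is `⟪Tw, w - Tw⟫ = ⟪u, Lu⟫`. Conversely, if `1/t - 1` lies in `L²(μ_u)`, then `w =
(1/t)(T) u` satisfies `Tw = u`, so `u ∈ D(L)`. -/
theorem isSpectralMeasureOf_resolventSpectralMeasure {T : H →L[ℂ] H} (hT : IsSelfAdjoint T)
    (hinj : ∀ x, T x = 0 → x = 0) {L : H →ₗ.[ℂ] H}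
    (hL : ∀ u w : H, (u, w) ∈ L.graph ↔ T (u + w) = u) :
    (resolventSpectralMeasure hT).IsSpectralMeasureOf L := by
  set Φ := (cfcHom hT : C(spectrum ℝ T, ℝ) →⋆ₐ[ℝ] (H →L[ℂ] H)) with hΦ
  let f : C(spectrum ℝ T, ℝ) := ContinuousMap.restrict (spectrum ℝ T) (ContinuousMap.id ℝ)
  have hf : Φ f = T := cfcHom_id hT
  have hft : ∀ t, f t = t := fun t => rfl
  have hm := measurable_resolventInverse (s := spectrum ℝ T)
  have hmf : Measurable fun t => ENNReal.ofReal (f t ^ 2) := by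
    have := f.continuous.measurable
    fun_prop
  have hμ : ∀ w, cyclicMeasure Φ (T w) =
      (cyclicMeasure Φ w).withDensity fun t => ENNReal.ofReal (f t ^ 2) := fun w => by
    have h := cyclicMeasure_starAlgHom_apply (Φ := Φ) f w
    have h' : Φ f w = T w := by rw [hf]
    rwa [h'] at h
  constructor
  · intro u
    rw [scalarMeasure_resolventSpectralMeasure, lintegral_map (by fun_prop) hm]
    constructor
    · intro hu
      have hg := (hL u (L ⟨u, hu⟩)).1 (L.mem_graph ⟨u, hu⟩)
      rw [← hg, hμ, lintegral_withDensity_eq_lintegral_mul _ hmf (by fun_prop)]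
      refine lt_of_le_of_lt (lintegral_mono (g := fun _ => ENNReal.ofReal ((1 + ‖f‖) ^ 2))
        fun t => ?_) ?_
      · simp only [Pi.mul_apply]
        rw [← ENNReal.ofReal_mul (sq_nonneg _), ← mul_pow]
        refine ENNReal.ofReal_le_ofReal (sq_le_sq.2 ?_)
        rw [abs_of_nonneg (by positivity : 0 ≤ 1 + ‖f‖)]
        have hb : |f t| ≤ ‖f‖ := f.norm_coe_le_norm t
        by_cases h0 : f t = 0
        · rw [h0, zero_mul, abs_zero]; positivity
        · have : f t * resolventInverse t = 1 - f t := by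
            rw [resolventInverse, ← hft t]; field_simp
          rw [this]
          exact (abs_sub _ _).trans (by rw [abs_one]; gcongr)
      · rw [lintegral_const]
        exact ENNReal.mul_lt_top ENNReal.ofReal_lt_top (measure_lt_top _ _)
    · intro hfin
      have h1 : MemLp (resolventInverse (s := spectrum ℝ T)) 2 (cyclicMeasure Φ u) := by
        rw [memLp_two_iff_integrable_sq hm.aestronglyMeasurable]
        refine ⟨(hm.pow_const 2).aestronglyMeasurable, ?_⟩
        rw [hasFiniteIntegral_iff_ofReal (.of_forall fun t => sq_nonneg _)]
        exact hfin
      have h2 : MemLp (fun t : spectrum ℝ T => resolventInverse t + 1) 2 (cyclicMeasure Φ u) :=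
        h1.add (memLp_const 1)
      have h3 := starAlgHom_borelApply f h2
      have h4 : (fun t : spectrum ℝ T => f t * (resolventInverse t + 1)) =ᵐ[cyclicMeasure Φ u]
          ⇑(1 : C(spectrum ℝ T, ℝ)) := by
        filter_upwards [ae_cyclicMeasure_ne_zero hT hinj u] with t ht
        rw [resolventInverse, hft]
        simp [ht]
      rw [borelApply_congr h4, borelApply_continuousMap, map_one, hf] at h3
      set w := borelApply Φ (fun t : spectrum ℝ T => resolventInverse t + 1) u
      have h5 : (u, w - u) ∈ L.graph := (hL _ _).2 (by rw [add_sub_cancel]; exact h3)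
      obtain ⟨y, hy, -⟩ := (LinearPMap.mem_graph_iff _).1 h5
      rw [show u = (y : H) from hy.symm]
      exact y.2
  · intro u
    have hg := (hL u (L u)).1 (L.mem_graph u)
    set w := (u : H) + L u with hw
    have hLu : L u = w - T w := by rw [hg, hw, add_sub_cancel_left]
    rw [scalarMeasure_resolventSpectralMeasure,
      integral_map hm.aemeasurable (by fun_prop), hLu, ← hg, hμ]
    have h1 : w - T w = Φ (1 - f) w := by
      rw [map_sub, map_one, hf]; rfl
    have h2 : ⟪T w, w - T w⟫_ℂ = ⟪w, Φ (f * (1 - f)) w⟫_ℂ := by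
      rw [starAlgHom_mul_apply, ← starAlgHom_inner_left, hf, h1]
    rw [h2, inner_starAlgHom_self]
    congr 1
    have hmf' : Measurable fun t => (f t ^ 2).toNNReal := by
      have := f.continuous.measurable
      fun_prop
    refine Eq.trans ?_ (integral_withDensity_eq_integral_smul hmf' _).symm
    refine integral_congr_ae (.of_forall fun t => ?_)
    simp only [NNReal.smul_def, Real.coe_toNNReal _ (sq_nonneg (f t)), smul_eq_mul,
      ContinuousMap.mul_apply, ContinuousMap.sub_apply, ContinuousMap.one_apply, resolventInverse,
      ← hft t]
    by_cases h0 : f t = 0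
    · simp [h0]
    · field_simp

end Resolvent

/-! ### The operator of a closed form -/

section ClosedForm

variable {H : Type*} [NormedAddCommGroup H] [InnerProductSpace ℂ H] [CompleteSpace H]
  {K : Type*} [NormedAddCommGroup K] [InnerProductSpace ℂ K] [CompleteSpace K]

/-- A densely defined form `q(v, u) = ⟪∇v, ∇u⟫` with a closed "gradient" `∇`, given by its graph
`S`, has an operator, and this operator has a spectral measure. -/
theorem HilbertForm.exists_spectralMeasure (q : HilbertForm H)
    (S : Submodule ℂ (WithLp 2 (H × K))) (hS : IsClosed (S : Set (WithLp 2 (H × K))))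
    (hdom : ∀ u, u ∈ q.domain ↔ ∃ g, WithLp.toLp 2 (u, g) ∈ S)
    (hq : ∀ u g v k, WithLp.toLp 2 (u, g) ∈ S → WithLp.toLp 2 (v, k) ∈ S →
      q.toFun v u = ⟪k, g⟫_ℂ)
    (hdense : Dense (q.domain : Set H)) :
    ∃ E : ProjectionValuedMeasure H, ∃ L : H →ₗ.[ℂ] H,
      q.IsOperatorOf L ∧ E.IsSpectralMeasureOf L := by
  have : CompleteSpace S := hS.completeSpace_coe
  -- `S` carries the form norm `(‖u‖² + ‖∇u‖²)^{1/2}`, and `J` forgets the gradient. By definition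
  -- of the adjoint, the element `(u, g) = J* f` of `S` solves `⟪v, u⟫ + ⟪∇v, g⟫ = ⟪v, f⟫` for all
  -- `v` in the form domain, so `T = J J*` is `(1 + L)⁻¹`.
  let J : S →L[ℂ] H := (WithLp.fstL 2 ℂ H K).comp S.subtypeL
  let T : H →L[ℂ] H := J.comp (ContinuousLinearMap.adjoint J)
  have hT : IsSelfAdjoint T := (ContinuousLinearMap.isPositive_self_comp_adjoint J).isSelfAdjoint
  have hchar : ∀ u w : H, T (u + w) = u ↔
      u ∈ q.domain ∧ ∀ v ∈ q.domain, q.toFun v u = ⟪v, w⟫_ℂ := by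
    intro u w
    constructor
    · intro h
      set s := ContinuousLinearMap.adjoint J (u + w) with hs
      have hsu : WithLp.toLp 2 (u, (s : WithLp 2 (H × K)).snd) ∈ S := by
        have h1 : WithLp.toLp 2 (u, (s : WithLp 2 (H × K)).snd) = (s : WithLp 2 (H × K)) := by
          rw [← h]; rfl
        rw [h1]
        exact s.2
      refine ⟨(hdom u).2 ⟨_, hsu⟩, fun v hv => ?_⟩
      obtain ⟨k, hk⟩ := (hdom v).1 hv
      have h2 : ⟪(⟨WithLp.toLp 2 (v, k), hk⟩ : S), s⟫_ℂ = ⟪v, u + w⟫_ℂ := by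
        rw [hs, ContinuousLinearMap.adjoint_inner_right]; rfl
      have h3 : ⟪(⟨WithLp.toLp 2 (v, k), hk⟩ : S), s⟫_ℂ =
          ⟪v, u⟫_ℂ + ⟪k, (s : WithLp 2 (H × K)).snd⟫_ℂ := by
        rw [Submodule.coe_inner, WithLp.prod_inner_apply]
        congr 2
      rw [hq _ _ _ _ hsu hk]
      rw [h3, inner_add_right] at h2
      exact add_left_cancel h2
    · rintro ⟨hu, h⟩
      obtain ⟨g, hg⟩ := (hdom u).1 hu
      have h1 : ContinuousLinearMap.adjoint J (u + w) = ⟨WithLp.toLp 2 (u, g), hg⟩ := by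
        refine ext_inner_left ℂ fun r => ?_
        have hr : WithLp.toLp 2 ((r : WithLp 2 (H × K)).fst, (r : WithLp 2 (H × K)).snd) ∈ S := r.2
        rw [ContinuousLinearMap.adjoint_inner_right, Submodule.coe_inner, WithLp.prod_inner_apply,
          inner_add_right]
        have h2 := h _ ((hdom _).2 ⟨_, hr⟩)
        rw [hq _ _ _ _ hg hr] at h2
        exact congrArg₂ (· + ·) rfl h2.symm
      change J (ContinuousLinearMap.adjoint J (u + w)) = u
      rw [h1]
      rfl
  -- `T w = 0` says that `(0, w)` satisfies the equation of the form, so `w` is orthogonal to the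
  -- dense domain.
  have hinj : ∀ w, T w = 0 → w = 0 := by
    intro w hw
    have h1 := ((hchar 0 w).1 (by rw [zero_add, hw])).2
    have h0 : WithLp.toLp 2 ((0 : H), (0 : K)) ∈ S := S.zero_mem
    have h2 : ∀ v ∈ q.domain, ⟪v, w⟫_ℂ = 0 := by
      intro v hv
      obtain ⟨k, hk⟩ := (hdom v).1 hv
      rw [← h1 v hv, hq _ _ _ _ h0 hk, inner_zero_right]
    exact hdense.eq_zero_of_inner_right ℂ h2
  -- The graph of `L` is `{(u, w) | T(u + w) = u}`; it is single-valued because `T` is injective.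
  let G : Submodule ℂ (H × H) :=
    LinearMap.ker ((T : H →ₗ[ℂ] H) ∘ₗ (LinearMap.fst ℂ H H + LinearMap.snd ℂ H H) -
      LinearMap.fst ℂ H H)
  have hG : ∀ u w, (u, w) ∈ G ↔ T (u + w) = u := fun u w => by
    simp [G, LinearMap.mem_ker, sub_eq_zero]
  have hgr : ∀ u w, (u, w) ∈ G.toLinearPMap.graph ↔ T (u + w) = u := by
    intro u w
    rw [Submodule.toLinearPMap_graph_eq, hG]
    rintro ⟨a, b⟩ hab rfl
    refine hinj b ?_
    have := (hG 0 b).1 hab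
    rwa [zero_add] at this
  exact ⟨resolventSpectralMeasure hT, G.toLinearPMap,
    fun u w => by rw [hgr, hchar], isSpectralMeasureOf_resolventSpectralMeasure hT hinj hgr⟩

end ClosedForm

/-! ### Calculus of projection-valued measures -/

section ProjectionValuedMeasure

variable {H : Type*} [NormedAddCommGroup H] [InnerProductSpace ℂ H] [CompleteSpace H]

namespace ProjectionValuedMeasure

variable (E : ProjectionValuedMeasure H)

theorem proj_union {A B : Set ℝ} (hA : MeasurableSet A) (hB : MeasurableSet B)
    (hd : Disjoint A B) (x : H) : E.proj (A ∪ B) x = E.proj A x + E.proj B x := by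
  -- Finite additivity follows from countable additivity by padding with empty sets.
  let C : ℕ → Set ℝ := fun i => if i = 0 then A else if i = 1 then B else ∅
  have hC : ∀ i, MeasurableSet (C i) := by
    intro i
    simp only [C]
    split_ifs <;> first | assumption | exact MeasurableSet.empty
  have hCd : Pairwise fun i j => Disjoint (C i) (C j) := by
    intro i j hij
    simp only [C]
    split_ifs <;> first | omega | exact hd | exact hd.symm | simp
  have hU : ⋃ i, C i = A ∪ B := by
    ext t
    simp only [mem_iUnion, mem_union, C]
    constructor
    · rintro ⟨i, hi⟩
      split_ifs at hi
      · exact .inl hi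
      · exact .inr hi
      · exact hi.elim
    · rintro (h | h)
      · exact ⟨0, by simpa using h⟩
      · exact ⟨1, by simpa using h⟩
  have h := E.hasSum_iUnion C hC hCd x
  rw [hU] at h
  refine h.unique ?_
  have h2 : HasSum (fun i => E.proj (C i) x) (∑ i ∈ ({0, 1} : Finset ℕ), E.proj (C i) x) :=
      hasSum_sum_of_ne_finset_zero (by
    intro i hi
    simp only [Finset.mem_insert, Finset.mem_singleton, not_or] at hi
    simp [C, hi.1, hi.2, E.proj_empty])
  simpa [C] using h2

theorem inner_proj_left {B : Set ℝ} (hB : MeasurableSet B) (x y : H) :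
    ⟪E.proj B x, y⟫_ℂ = ⟪x, E.proj B y⟫_ℂ := by
  have h2 : ContinuousLinearMap.adjoint (E.proj B) = E.proj B :=
    (E.isStarProjection B hB).isSelfAdjoint.star_eq
  conv_lhs => rw [← h2]
  exact ContinuousLinearMap.adjoint_inner_left _ _ _

theorem proj_proj_self {B : Set ℝ} (hB : MeasurableSet B) (x : H) :
    E.proj B (E.proj B x) = E.proj B x :=
  congrArg (fun T : H →L[ℂ] H => T x) (E.isStarProjection B hB).isIdempotentElem.eq

theorem norm_proj_union_sq {A B : Set ℝ} (hA : MeasurableSet A) (hB : MeasurableSet B)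
    (hd : Disjoint A B) (x : H) :
    ‖E.proj (A ∪ B) x‖ ^ 2 = ‖E.proj A x‖ ^ 2 + ‖E.proj B x‖ ^ 2 := by
  have h := E.inner_proj_self (hA.union hB) x
  rw [E.proj_union hA hB hd, inner_add_right, E.inner_proj_self hA, E.inner_proj_self hB,
    ← E.proj_union hA hB hd] at h
  exact_mod_cast h.symm

theorem norm_sq_eq_add_compl {B : Set ℝ} (hB : MeasurableSet B) (x : H) :
    ‖x‖ ^ 2 = ‖E.proj B x‖ ^ 2 + ‖E.proj Bᶜ x‖ ^ 2 := by
  rw [← E.norm_proj_union_sq hB hB.compl disjoint_compl_right, union_compl_self, E.proj_univ]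
  rfl

/-- With `y = E(B)x`, additivity of the squared norms gives `‖E(A)y‖² + ‖y‖² = ‖E(A ∪ B)y‖² ≤ ‖y‖²`.
-/
theorem proj_proj_of_disjoint {A B : Set ℝ} (hA : MeasurableSet A) (hB : MeasurableSet B)
    (hd : Disjoint A B) (x : H) : E.proj A (E.proj B x) = 0 := by
  have h1 := E.norm_proj_union_sq hA hB hd (E.proj B x)
  rw [E.proj_proj_self hB] at h1
  have h2 := E.norm_sq_eq_add_compl (hA.union hB) (E.proj B x)
  have h3 : ‖E.proj A (E.proj B x)‖ ^ 2 = 0 := by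
    have := sq_nonneg ‖E.proj A (E.proj B x)‖
    have := sq_nonneg ‖E.proj (A ∪ B)ᶜ (E.proj B x)‖
    linarith
  simpa using h3

theorem proj_proj {A B : Set ℝ} (hA : MeasurableSet A) (hB : MeasurableSet B) (x : H) :
    E.proj A (E.proj B x) = E.proj (A ∩ B) x := by
  have h1 : E.proj B x = E.proj (B ∩ A) x + E.proj (B \ A) x := by
    rw [← E.proj_union (hB.inter hA) (hB.diff hA) (disjoint_inf_sdiff), inter_union_sdiff]
  have h2 : E.proj A (E.proj (B ∩ A) x) =
      E.proj (A ∩ B) (E.proj (A ∩ B) x) + E.proj (A \ B) (E.proj (A ∩ B) x) := by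
    rw [← E.proj_union (hA.inter hB) (hA.diff hB) (disjoint_inf_sdiff), inter_union_sdiff,
      inter_comm]
  rw [h1, map_add, E.proj_proj_of_disjoint hA (hB.diff hA) disjoint_sdiff_right, add_zero, h2,
    E.proj_proj_self (hA.inter hB), E.proj_proj_of_disjoint (hA.diff hB) (hA.inter hB)
      (disjoint_inf_sdiff.symm), add_zero]

theorem scalarMeasure_univ (x : H) : E.scalarMeasure x univ = ENNReal.ofReal (‖x‖ ^ 2) := by
  rw [E.scalarMeasure_apply x MeasurableSet.univ, E.proj_univ]
  rfl

instance (x : H) : IsFiniteMeasure (E.scalarMeasure x) :=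
  ⟨by rw [E.scalarMeasure_univ]; exact ENNReal.ofReal_lt_top⟩

theorem scalarMeasure_real_apply (x : H) {B : Set ℝ} (hB : MeasurableSet B) :
    (E.scalarMeasure x).real B = ‖E.proj B x‖ ^ 2 := by
  rw [measureReal_def, E.scalarMeasure_apply x hB, ENNReal.toReal_ofReal (by positivity)]

theorem scalarMeasure_proj {B : Set ℝ} (hB : MeasurableSet B) (x : H) :
    E.scalarMeasure (E.proj B x) = (E.scalarMeasure x).restrict B := by
  ext A hA
  rw [E.scalarMeasure_apply _ hA, Measure.restrict_apply hA, E.scalarMeasure_apply _ (hA.inter hB),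
    E.proj_proj hA hB]

theorem scalarMeasure_add_of_disjoint {A B : Set ℝ} (hA : MeasurableSet A) (hB : MeasurableSet B)
    (hd : Disjoint A B) {x y : H} (hx : E.proj A x = x) (hy : E.proj B y = y) :
    E.scalarMeasure (x + y) = E.scalarMeasure x + E.scalarMeasure y := by
  ext C hC
  rw [Measure.add_apply, E.scalarMeasure_apply _ hC, E.scalarMeasure_apply _ hC,
    E.scalarMeasure_apply _ hC, ← ENNReal.ofReal_add (by positivity) (by positivity), map_add]
  congr 1
  have h : ⟪E.proj C x, E.proj C y⟫_ℂ = 0 := by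
    rw [E.inner_proj_left hC, E.proj_proj_self hC, ← hy, ← hx, E.proj_proj hC hB,
      E.inner_proj_left hA, E.proj_proj_of_disjoint hA (hC.inter hB)
        (hd.mono_right inter_subset_right), inner_zero_right]
  rw [@norm_add_sq ℂ, h]
  simp

theorem tendsto_proj {B : ℕ → Set ℝ} (hB : ∀ i, MeasurableSet (B i)) (hmono : Monotone B)
    (x : H) : Tendsto (fun k => E.proj (B k) x) atTop (𝓝 (E.proj (⋃ k, B k) x)) := by
  have hU := MeasurableSet.iUnion hB
  have h1 : Tendsto (fun k => (E.scalarMeasure x).real (B k)) atTop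
      (𝓝 ((E.scalarMeasure x).real (⋃ k, B k))) :=
    (ENNReal.tendsto_toReal (measure_ne_top _ _)).comp (tendsto_measure_iUnion_atTop hmono)
  rw [tendsto_iff_norm_sub_tendsto_zero]
  have h2 : ∀ k, ‖E.proj (B k) x - E.proj (⋃ k, B k) x‖ ^ 2 =
      (E.scalarMeasure x).real (⋃ k, B k) - (E.scalarMeasure x).real (B k) := by
    intro k
    have hsub := subset_iUnion B k
    have h3 := E.proj_union (hB k) (hU.diff (hB k)) disjoint_sdiff_right x
    rw [union_sdiff_cancel hsub] at h3
    rw [h3, sub_add_cancel_left, norm_neg, ← E.scalarMeasure_real_apply x (hU.diff (hB k)),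
      measureReal_sdiff hsub (hB k)]
  have h3 : Tendsto (fun k => ‖E.proj (B k) x - E.proj (⋃ k, B k) x‖ ^ 2) atTop (𝓝 0) := by
    simp only [h2]
    have h4 := (tendsto_const_nhds (x := (E.scalarMeasure x).real (⋃ k, B k))).sub h1
    rwa [sub_self] at h4
  simpa using h3.sqrt

/-! ### An operator and its spectral projections -/

variable {E} {L : H →ₗ.[ℂ] H}

theorem integrable_id_of_bounded {μ : Measure ℝ} [IsFiniteMeasure μ] {a b : ℝ} {B : Set ℝ}
    (hB : B ⊆ Icc a b) : IntegrableOn (fun t : ℝ => t) B μ := by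
  have h : IntegrableOn (fun t : ℝ => t) (Icc a b) μ :=
    continuous_id.continuousOn.integrableOn_compact isCompact_Icc
  exact h.mono_set hB

theorem IsSpectralMeasureOf.proj_mem_domain (hE : E.IsSpectralMeasureOf L) {a b : ℝ}
    {B : Set ℝ} (hBm : MeasurableSet B)
    (hB : B ⊆ Icc a b) (x : H) : E.proj B x ∈ L.domain := by
  rw [hE.1, E.scalarMeasure_proj hBm]
  have h : IntegrableOn (fun t : ℝ => t ^ 2) (Icc a b) (E.scalarMeasure x) :=
    (continuous_pow 2).continuousOn.integrableOn_compact isCompact_Icc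
  have h1 := (h.mono_set hB).2
  rwa [hasFiniteIntegral_iff_ofReal (.of_forall fun t => sq_nonneg _)] at h1

/-- `IsSpectralMeasureOf` only prescribes the diagonal values `⟪u, Lu⟫`, so off-diagonal values come
from polarization. For `z`, `w` in the two ranges the scalar measures add, whence `⟪z, Lw⟫ + ⟪w, Lz⟫
= 0`. Replacing `z` by `iz` gives `⟪z, Lw⟫ - ⟪w, Lz⟫ = 0`, so both vanish. -/
theorem IsSpectralMeasureOf.inner_apply_eq_zero_of_bounded (hE : E.IsSpectralMeasureOf L)
    {a b : ℝ} {A B : Set ℝ} (hA : MeasurableSet A) (hB : MeasurableSet B) (hAb : A ⊆ Icc a b)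
    (hBb : B ⊆ Icc a b) (hd : Disjoint A B) (x y : H) :
    ⟪E.proj A y, L ⟨E.proj B x, hE.proj_mem_domain hB hBb x⟩⟫_ℂ = 0 := by
  have key : ∀ y : H, ⟪E.proj A y, L ⟨E.proj B x, hE.proj_mem_domain hB hBb x⟩⟫_ℂ +
      ⟪E.proj B x, L ⟨E.proj A y, hE.proj_mem_domain hA hAb y⟩⟫_ℂ = 0 := by
    intro y
    set z : L.domain := ⟨E.proj A y, hE.proj_mem_domain hA hAb y⟩ with hz
    set w : L.domain := ⟨E.proj B x, hE.proj_mem_domain hB hBb x⟩ with hw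
    have h1 := hE.2 (z + w)
    have h2 : E.scalarMeasure ((z + w : L.domain) : H) =
        E.scalarMeasure (z : H) + E.scalarMeasure (w : H) :=
      E.scalarMeasure_add_of_disjoint hA hB hd (E.proj_proj_self hA y) (E.proj_proj_self hB x)
    have hzi : Integrable (fun t : ℝ => t) (E.scalarMeasure (z : H)) := by
      rw [hz, E.scalarMeasure_proj hA]; exact integrable_id_of_bounded hAb
    have hwi : Integrable (fun t : ℝ => t) (E.scalarMeasure (w : H)) := by
      rw [hw, E.scalarMeasure_proj hB]; exact integrable_id_of_bounded hBb
    rw [h2, integral_add_measure hzi hwi, L.map_add, Submodule.coe_add, inner_add_left,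
      inner_add_right, inner_add_right, hE.2 z, hE.2 w] at h1
    push_cast at h1
    linear_combination h1
  have h1 := key y
  have h2 := key (Complex.I • y)
  have h3 : L ⟨E.proj A (Complex.I • y), hE.proj_mem_domain hA hAb (Complex.I • y)⟩ =
      Complex.I • L ⟨E.proj A y, hE.proj_mem_domain hA hAb y⟩ := by
    rw [← L.map_smul]
    congr 1
    exact Subtype.ext (map_smul _ _ _)
  rw [h3, map_smul, inner_smul_left, inner_smul_right, Complex.conj_I] at h2
  linear_combination (1 / 2 : ℂ) * h1 + (Complex.I / 2) * h2 +
    (1 / 2 * ⟪E.proj A y, L ⟨E.proj B x, hE.proj_mem_domain hB hBb x⟩⟫_ℂ - 1 / 2 *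
      ⟪E.proj B x, L ⟨E.proj A y, hE.proj_mem_domain hA hAb y⟩⟫_ℂ) * Complex.I_sq

/-- The definition gives this with `E(B)x` in the left slot; the component `E(Bᶜ)x` contributes
nothing. -/
theorem IsSpectralMeasureOf.inner_apply_proj (hE : E.IsSpectralMeasureOf L)
    {a b : ℝ} {B : Set ℝ} (hB : MeasurableSet B) (hBb : B ⊆ Icc a b) (x : H) :
    ⟪x, L ⟨E.proj B x, hE.proj_mem_domain hB hBb x⟩⟫_ℂ =
      ((∫ t in B, t ∂(E.scalarMeasure x) : ℝ) : ℂ) := by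
  have h1 := hE.2 ⟨E.proj B x, hE.proj_mem_domain hB hBb x⟩
  simp only [E.scalarMeasure_proj hB] at h1
  rw [← h1]
  have hx : x = E.proj B x + E.proj Bᶜ x := by
    rw [← E.proj_union hB hB.compl disjoint_compl_right, union_compl_self, E.proj_univ]
    rfl
  have h2 : ⟪E.proj Bᶜ x, L ⟨E.proj B x, hE.proj_mem_domain hB hBb x⟩⟫_ℂ = 0 := by
    -- Orthogonality is available only for bounded sets, so `Bᶜ` is exhausted by `Bᶜ ∩ [-k, k]`.
    let C : ℕ → Set ℝ := fun k => Bᶜ ∩ Icc (-k : ℝ) k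
    have hC : ∀ k, MeasurableSet (C k) := fun k => hB.compl.inter measurableSet_Icc
    have hCm : Monotone C := by
      intro i j hij
      have : (i : ℝ) ≤ j := by exact_mod_cast hij
      exact inter_subset_inter_right _ (Icc_subset_Icc (by linarith) this)
    have hCU : ⋃ k, C k = Bᶜ := by
      rw [← inter_iUnion]
      refine inter_eq_left.2 fun t _ => ?_
      obtain ⟨k, hk⟩ := exists_nat_ge |t|
      exact mem_iUnion.2 ⟨k, abs_le.1 hk⟩
    have h3 := E.tendsto_proj hC hCm x
    rw [hCU] at h3
    have h4 := h3.inner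
      (tendsto_const_nhds (x := L ⟨E.proj B x, hE.proj_mem_domain hB hBb x⟩) (f := atTop)) (𝕜 := ℂ)
    refine tendsto_nhds_unique h4 (tendsto_const_nhds.congr fun k => Eq.symm ?_)
    exact hE.inner_apply_eq_zero_of_bounded (hC k) hB (a := min (-k : ℝ) a) (b := max (k : ℝ) b)
      (inter_subset_right.trans (Icc_subset_Icc (min_le_left _ _) (le_max_left _ _)))
      (hBb.trans (Icc_subset_Icc (min_le_right _ _) (le_max_right _ _)))
      (disjoint_compl_left.mono_left inter_subset_left) x x
  refine (congrArg (fun z => ⟪z, L ⟨E.proj B x, hE.proj_mem_domain hB hBb x⟩⟫_ℂ) hx).trans ?_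
  simp only [inner_add_left, h2, add_zero]

end ProjectionValuedMeasure
end ProjectionValuedMeasure

/-! ### Comparison of counting functions -/

section Comparison

set_option linter.unusedSectionVars false

variable {H : Type*} [NormedAddCommGroup H] [InnerProductSpace ℂ H] [CompleteSpace H]
  {K : Type*} [NormedAddCommGroup K] [InnerProductSpace ℂ K]
  {q : HilbertForm H} {E : ProjectionValuedMeasure H} {L : H →ₗ.[ℂ] H}

theorem HilbertForm.IsOperatorOf.mem_domain (hL : q.IsOperatorOf L) (u : L.domain) :
    (u : H) ∈ q.domain := ((hL _ _).1 (L.mem_graph u)).1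

theorem HilbertForm.IsOperatorOf.toFun_eq (hL : q.IsOperatorOf L) {v : H} (hv : v ∈ q.domain)
    (u : L.domain) : q.toFun v u = ⟪v, L u⟫_ℂ := ((hL _ _).1 (L.mem_graph u)).2 v hv

/-- The form is at most `β‖u‖²` on the range of the projection of a bounded part of `(-∞, β]`. -/
theorem ProjectionValuedMeasure.IsSpectralMeasureOf.form_le (hE : E.IsSpectralMeasureOf L)
    (hL : q.IsOperatorOf L) {a β : ℝ} {u : H} (hu : E.proj (Ioc a β) u = u) :
    u ∈ q.domain ∧ ∃ r : ℝ, q.toFun u u = r ∧ r ≤ β * ‖u‖ ^ 2 := by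
  have hd := hE.proj_mem_domain (measurableSet_Ioc (a := a) (b := β)) Ioc_subset_Icc_self u
  rw [hu] at hd
  have hq := hL.mem_domain ⟨u, hd⟩
  refine ⟨hq, _, (hL.toFun_eq hq ⟨u, hd⟩).trans (hE.2 ⟨u, hd⟩), ?_⟩
  have h1 : E.scalarMeasure u = (E.scalarMeasure u).restrict (Ioc a β) := by
    conv_lhs => rw [← hu]
    exact E.scalarMeasure_proj measurableSet_Ioc u
  have h2 : (E.scalarMeasure u).real (Ioc a β) = ‖u‖ ^ 2 := by
    rw [E.scalarMeasure_real_apply u measurableSet_Ioc, hu]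
  rw [h1, ← h2, mul_comm, ← smul_eq_mul, ← setIntegral_const]
  exact setIntegral_mono_on (ProjectionValuedMeasure.integrable_id_of_bounded Ioc_subset_Icc_self)
    (integrable_const _).integrableOn measurableSet_Ioc fun t ht => ht.2

/-- The form exceeds `β‖u‖²` on the orthogonal complement of the range of `E((-∞, β])`. -/
theorem ProjectionValuedMeasure.IsSpectralMeasureOf.lt_form (hE : E.IsSpectralMeasureOf L)
    (hL : q.IsOperatorOf L) (D : q.domain →ₗ[ℂ] K)
    (hD : ∀ u v : q.domain, q.toFun u v = ⟪D u, D v⟫_ℂ) {β : ℝ} (u : q.domain)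
    (hu : E.proj (Iic β) u = 0) (hu0 : u ≠ 0) : β * ‖u‖ ^ 2 < ‖D u‖ ^ 2 := by
  set μ := E.scalarMeasure (u : H) with hμ
  let B : ℕ → Set ℝ := fun N => Ioc β (β + N)
  have hB : ∀ N, MeasurableSet (B N) := fun N => measurableSet_Ioc
  have hBb : ∀ N, B N ⊆ Icc β (β + N) := fun N => Ioc_subset_Icc_self
  have hBm : Monotone B := fun i j hij => by
    have : (i : ℝ) ≤ j := by exact_mod_cast hij
    exact Ioc_subset_Ioc_right (by linarith)
  have hBU : ⋃ N, B N = Ioi β := by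
    ext t
    simp only [B, mem_iUnion, mem_Ioc, mem_Ioi]
    refine ⟨fun ⟨N, h⟩ => h.1, fun h => ?_⟩
    obtain ⟨N, hN⟩ := exists_nat_ge (t - β)
    exact ⟨N, h, by linarith⟩
  -- A Bessel inequality. For `w = E(B_N)u` both `q(u, w)` and `q(w, w)` equal `∫_{B_N} t dμ`, so
  -- Cauchy–Schwarz gives `‖Dw‖² ≤ ‖Du‖‖Dw‖`. Only the operator equation for `w` is used, so no
  -- description of the form domain by the spectral measure is required.
  have hform : ∀ N, ∫ t in B N, t ∂μ ≤ ‖D u‖ ^ 2 := by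
    intro N
    set w : L.domain := ⟨E.proj (B N) u, hE.proj_mem_domain (hB N) (hBb N) u⟩
    have hwq := hL.mem_domain w
    have h1 : ⟪D u, D ⟨w, hwq⟩⟫_ℂ = ((∫ t in B N, t ∂μ : ℝ) : ℂ) := by
      rw [← hD]
      refine (hL.toFun_eq u.2 w).trans ?_
      exact hE.inner_apply_proj (hB N) (hBb N) u
    have h2 : ⟪D ⟨w, hwq⟩, D ⟨w, hwq⟩⟫_ℂ = ((∫ t in B N, t ∂μ : ℝ) : ℂ) := by
      rw [← hD]
      refine ((hL.toFun_eq hwq w).trans (hE.2 w)).trans ?_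
      change ((∫ t, t ∂(E.scalarMeasure (E.proj (B N) u)) : ℝ) : ℂ) = _
      rw [E.scalarMeasure_proj (hB N)]
    have h3 : ‖D ⟨w, hwq⟩‖ ^ 2 = ∫ t in B N, t ∂μ := by
      exact (inner_self_eq_norm_sq (𝕜 := ℂ) _).symm.trans
        ((congrArg Complex.re h2).trans (Complex.ofReal_re _))
    have h4 : ‖D ⟨w, hwq⟩‖ ^ 2 ≤ ‖D u‖ * ‖D ⟨w, hwq⟩‖ := by
      have := norm_inner_le_norm (𝕜 := ℂ) (D u) (D ⟨w, hwq⟩)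
      rw [h1, ← h3, Complex.norm_real, Real.norm_of_nonneg (by positivity)] at this
      exact this
    rw [← h3]
    nlinarith [norm_nonneg (D u), norm_nonneg (D ⟨w, hwq⟩), sq_nonneg (‖D u‖ - ‖D ⟨w, hwq⟩‖)]
  have hlim : Tendsto (fun N => μ.real (B N)) atTop (𝓝 (‖(u : H)‖ ^ 2)) := by
    have h1 : ‖(u : H)‖ ^ 2 = μ.real (⋃ N, B N) := by
      rw [hBU, hμ, E.scalarMeasure_real_apply _ measurableSet_Ioi,
        E.norm_sq_eq_add_compl (measurableSet_Iic (a := β)) (u : H), hu, compl_Iic]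
      simp
    rw [h1]
    exact (ENNReal.tendsto_toReal (measure_ne_top _ _)).comp (tendsto_measure_iUnion_atTop hBm)
  -- The inequality must be strict, since `(-∞, β]` contains `β`. If `‖Du‖² ≤ β‖u‖²`, then `∫_{B_N}
  -- (t - β) dμ ≤ β(‖u‖² - μ(B_N))`. The right side tends to `0` while the left side increases with
  -- `N`, so every left side is `0`. As `t > β` on `B_N`, this forces `μ(B_N) = 0` and `u = 0`.
  by_contra hcon
  push Not at hcon
  have hint : ∀ N, IntegrableOn (fun t => t - β) (B N) μ := fun N =>
    (ProjectionValuedMeasure.integrable_id_of_bounded (hBb N)).sub (integrable_const _).integrableOn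
  have hnn : ∀ N, 0 ≤ᵐ[μ.restrict (B N)] fun t => t - β := fun N => by
    filter_upwards [ae_restrict_mem (hB N)] with t ht
    exact sub_nonneg.2 ht.1.le
  have hle : ∀ N, ∫ t in B N, (t - β) ∂μ ≤ β * (‖(u : H)‖ ^ 2 - μ.real (B N)) := by
    intro N
    rw [integral_sub (ProjectionValuedMeasure.integrable_id_of_bounded (hBb N))
      (integrable_const _).integrableOn, setIntegral_const, smul_eq_mul]
    have h1 := hform N
    have h2 : β * ‖(u : H)‖ ^ 2 ≥ ‖D u‖ ^ 2 := hcon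
    linarith
  have hzero : ∀ N, ∫ t in B N, (t - β) ∂μ ≤ 0 := by
    intro N
    have h1 : Tendsto (fun M => β * (‖(u : H)‖ ^ 2 - μ.real (B M))) atTop (𝓝 0) := by
      have := (tendsto_const_nhds (x := ‖(u : H)‖ ^ 2)).sub hlim |>.const_mul β
      rwa [sub_self, mul_zero] at this
    refine ge_of_tendsto h1 (eventually_atTop.2 ⟨N, fun M hM => ?_⟩)
    exact (setIntegral_mono_set (hint M) (hnn M) (hBm hM).eventuallyLE).trans (hle M)
  have hmeas : ∀ N, μ.real (B N) = 0 := by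
    intro N
    have h1 : ∫ t in B N, (t - β) ∂μ = 0 :=
      le_antisymm (hzero N) (integral_nonneg_of_ae (hnn N))
    rw [setIntegral_eq_zero_iff_of_nonneg_ae (hnn N) (hint N)] at h1
    have h2 : ∀ᵐ t ∂μ.restrict (B N), False := by
      filter_upwards [h1, ae_restrict_mem (hB N)] with t ht ht'
      simp only [Pi.zero_apply] at ht
      exact absurd ht (sub_pos.2 ht'.1).ne'
    rw [ae_iff, not_false_eq_true, ofPred_true, Measure.restrict_apply_univ] at h2
    exact (measureReal_eq_zero_iff (measure_ne_top _ _)).2 h2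
  simp only [hmeas] at hlim
  have h3 := tendsto_nhds_unique hlim tendsto_const_nhds
  exact hu0 (by simpa using h3)

/-- Vectors in the range of `E((a, β])` lie in the operator domain, which is why bounded pieces are
compared. Linear independence of finitely many vectors is an open condition and `E((-N, β])v → v` on
the range of `E((-∞, β])`, so finitely many independent vectors stay independent for some `N`. No
lower bound on the spectrum enters. -/
theorem ProjectionValuedMeasure.toENat_rank_range_le (E : ProjectionValuedMeasure H) (β : ℝ)
    {c : ℕ∞} (h : ∀ a : ℝ, (Module.rank ℂ (E.proj (Ioc a β)).range).toENat ≤ c) :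
    (Module.rank ℂ (E.proj (Iic β)).range).toENat ≤ c := by
  refine ENat.forall_natCast_le_iff_le.1 fun k hk => ?_
  rw [Cardinal.natCast_le_toENat, Module.le_rank_iff] at hk
  obtain ⟨v, hv⟩ := hk
  have hv' : LinearIndependent ℂ fun i => (v i : H) :=
    hv.map' (E.proj (Iic β)).range.subtype (Submodule.ker_subtype _)
  let B : ℕ → Set ℝ := fun N => Ioc (-(N : ℝ)) β
  have hBm : Monotone B := fun i j hij => by
    have : (i : ℝ) ≤ j := by exact_mod_cast hij
    exact Ioc_subset_Ioc_left (by linarith)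
  have hBU : ⋃ N, B N = Iic β := by
    ext t
    simp only [B, mem_iUnion, mem_Ioc, mem_Iic]
    refine ⟨fun ⟨N, h⟩ => h.2, fun h => ?_⟩
    obtain ⟨N, hN⟩ := exists_nat_gt (-t)
    exact ⟨N, by linarith, h⟩
  have hlim : Tendsto (fun N => fun i => E.proj (B N) (v i)) atTop (𝓝 fun i => (v i : H)) := by
    rw [tendsto_pi_nhds]
    intro i
    have h1 := E.tendsto_proj (fun N => measurableSet_Ioc) hBm (v i : H)
    rw [hBU] at h1
    obtain ⟨y, hy⟩ := (v i).2
    have h2 : E.proj (Iic β) (v i) = v i := by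
      rw [← hy]; exact E.proj_proj_self measurableSet_Iic y
    rwa [h2] at h1
  obtain ⟨N, hN⟩ := (hlim.eventually hv'.eventually).exists
  refine le_trans ?_ (h (-(N : ℝ)))
  rw [Cardinal.natCast_le_toENat, Module.le_rank_iff]
  refine ⟨fun i => ⟨E.proj (B N) (v i), ⟨_, rfl⟩⟩, ?_⟩
  exact LinearIndependent.of_comp (E.proj (B N)).range.subtype hN

/-- The map `E₂((-∞, β₂]) ∘ J` is injective on the range of `E₁((a, β₁])`: a nonzero vector in its
kernel would have form value above `β₂‖Ju‖²` by `lt_form`. The argument applies to whichever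
spectral measures are chosen, so their uniqueness plays no role. If `q₁` has no spectral measure,
the left side is `0`. -/
theorem HilbertForm.countingFunction_le {H₁ H₂ : Type} [NormedAddCommGroup H₁]
    [InnerProductSpace ℂ H₁] [CompleteSpace H₁] [NormedAddCommGroup H₂] [InnerProductSpace ℂ H₂]
    [CompleteSpace H₂] {q₁ : HilbertForm H₁} {q₂ : HilbertForm H₂} {β₁ β₂ : ℝ}
    (hex : ∃ E : ProjectionValuedMeasure H₂, ∃ L : H₂ →ₗ.[ℂ] H₂,
      q₂.IsOperatorOf L ∧ E.IsSpectralMeasureOf L)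
    (D : q₂.domain →ₗ[ℂ] K) (hD : ∀ u v : q₂.domain, q₂.toFun u v = ⟪D u, D v⟫_ℂ)
    (hJ : ∀ M : Submodule ℂ H₁,
      (∀ u ∈ M, u ∈ q₁.domain ∧ ∃ r : ℝ, q₁.toFun u u = r ∧ r ≤ β₁ * ‖u‖ ^ 2) →
      ∃ J : M →ₗ[ℂ] q₂.domain, Function.Injective J ∧ ∀ u, ‖D (J u)‖ ^ 2 ≤ β₂ * ‖J u‖ ^ 2) :
    q₁.countingFunction β₁ ≤ q₂.countingFunction β₂ := by
  rw [HilbertForm.countingFunction, HilbertForm.countingFunction, dif_pos hex]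
  split_ifs with h
  · obtain ⟨L₁, hL₁, hE₁⟩ := h.choose_spec
    obtain ⟨L₂, hL₂, hE₂⟩ := hex.choose_spec
    set E₁ := h.choose
    set E₂ := hex.choose
    refine E₁.toENat_rank_range_le β₁ fun a => ?_
    have hrange : ∀ u ∈ (E₁.proj (Ioc a β₁)).range, E₁.proj (Ioc a β₁) u = u := by
      rintro _ ⟨y, rfl⟩
      exact E₁.proj_proj_self measurableSet_Ioc y
    obtain ⟨J, hJi, hJle⟩ := hJ (E₁.proj (Ioc a β₁)).range
      fun u hu => hE₁.form_le hL₁ (hrange u hu)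
    let P : (E₁.proj (Ioc a β₁)).range →ₗ[ℂ] (E₂.proj (Iic β₂)).range :=
      (E₂.proj (Iic β₂)).toLinearMap.rangeRestrict ∘ₗ q₂.domain.subtype ∘ₗ J
    have hP : Function.Injective P := by
      rw [← LinearMap.ker_eq_bot, LinearMap.ker_eq_bot']
      intro u hu
      by_contra hu0
      have h1 : E₂.proj (Iic β₂) (J u) = 0 := congrArg Subtype.val hu
      have h2 : J u ≠ 0 := fun h0 => hu0 (hJi (h0.trans (map_zero J).symm))
      exact absurd (hE₂.lt_form hL₂ D hD (J u) h1 h2) (not_lt.2 (hJle u))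
    exact Cardinal.toENat.monotone' (LinearMap.rank_le_of_injective P hP)
  · exact zero_le

end Comparison

/-! ### Weak gradients -/

section WeakGradient

variable {n : ℕ} {Ω U : Set (EuclideanSpace ℝ (Fin n))} {m : Measure (EuclideanSpace ℝ (Fin n))}

/-- On compact subsets of `Ω`, Lebesgue measure is bounded by a multiple of `m`. -/
def LocallyDominatesVolume (Ω : Set (EuclideanSpace ℝ (Fin n)))
    (m : Measure (EuclideanSpace ℝ (Fin n))) : Prop :=
  ∀ K : Set (EuclideanSpace ℝ (Fin n)), IsCompact K → K ⊆ Ω →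
    ∃ c : ℝ≥0∞, c ≠ ⊤ ∧ volume.restrict K ≤ c • m

theorem locallyDominatesVolume_restrict : LocallyDominatesVolume Ω (volume.restrict Ω) :=
  fun _ _ hK => ⟨1, ENNReal.one_ne_top, by rw [one_smul]; exact Measure.restrict_mono hK le_rfl⟩

theorem LocallyDominatesVolume.isL2Loc (hm : LocallyDominatesVolume Ω m)
    {u : EuclideanSpace ℝ (Fin n) → ℂ} (hu : MemLp u 2 m) : IsL2Loc Ω u := fun K hK hKΩ => by
  obtain ⟨c, hc, hcm⟩ := hm K hK hKΩ
  exact hu.of_measure_le_smul hc hcm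

/-- Convergence in `L²(m)` gives convergence in `L²(K, dx)` by domination, hence in `L¹(K, dx)`, and
`g` is bounded. This passes the identity defining a weak gradient to limits, which makes the
Dirichlet form closed. -/
theorem LocallyDominatesVolume.tendsto_integral_mul (hm : LocallyDominatesVolume Ω m)
    {u : ℕ → EuclideanSpace ℝ (Fin n) → ℂ} {v : EuclideanSpace ℝ (Fin n) → ℂ}
    (hu : ∀ k, MemLp (u k) 2 m) (hv : MemLp v 2 m)
    (huv : Tendsto (fun k => eLpNorm (u k - v) 2 m) atTop (𝓝 0))
    {K : Set (EuclideanSpace ℝ (Fin n))} (hK : IsCompact K) (hKΩ : K ⊆ Ω)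
    {g : EuclideanSpace ℝ (Fin n) → ℂ} (hg : Continuous g) (hgK : ∀ x ∉ K, g x = 0) :
    Tendsto (fun k => ∫ x in Ω, u k x * g x) atTop (𝓝 (∫ x in Ω, v x * g x)) := by
  have hred : ∀ w : EuclideanSpace ℝ (Fin n) → ℂ,
      ∫ x in Ω, w x * g x = ∫ x in K, w x * g x := fun w => by
    rw [setIntegral_eq_integral_of_forall_compl_eq_zero (s := Ω),
      setIntegral_eq_integral_of_forall_compl_eq_zero (s := K)]
    · intro x hx; rw [hgK x hx, mul_zero]
    · intro x hx; rw [hgK x fun h => hx (hKΩ h), mul_zero]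
  simp only [hred]
  have hfin : IsFiniteMeasure (volume.restrict K) := ⟨by simpa using hK.measure_lt_top⟩
  obtain ⟨c, hc, hcm⟩ := hm K hK hKΩ
  obtain ⟨C, hC⟩ := hK.exists_bound_of_continuousOn hg.continuousOn
  have hC' : ∀ x, ‖g x‖ ≤ |C| := fun x => by
    by_cases hx : x ∈ K
    · exact (hC x hx).trans (le_abs_self C)
    · rw [hgK x hx, norm_zero]; exact abs_nonneg C
  have hgb : MemLp g ⊤ (volume.restrict K) :=
    memLp_top_of_bound hg.aestronglyMeasurable _ (.of_forall hC')
  have huK : ∀ k, MemLp (u k) 2 (volume.restrict K) := fun k => (hu k).of_measure_le_smul hc hcm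
  have hvK : MemLp v 2 (volume.restrict K) := hv.of_measure_le_smul hc hcm
  refine tendsto_integral_of_L1' (F := fun k x => u k x * g x) _
    ((hgb.mul hvK (r := 2)).1) (.of_forall fun k => (hgb.mul (huK k) (r := 2)).integrable
      (by norm_num)) ?_
  have hbound : ∀ k, eLpNorm ((fun x => u k x * g x) - fun x => v x * g x) 1 (volume.restrict K) ≤
      ENNReal.ofReal |C| * ((c ^ (1 / (2 : ℝ≥0∞)).toReal • eLpNorm (u k - v) 2 m) *
        volume.restrict K univ ^ (1 / (1 : ℝ≥0∞).toReal - 1 / (2 : ℝ≥0∞).toReal)) := by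
    intro k
    refine (eLpNorm_le_mul_eLpNorm_of_ae_le_mul (g := u k - v) (c := |C|)
      (.of_forall fun x => ?_) _).trans (mul_le_mul_right ?_ _)
    · simp only [Pi.sub_apply, ← sub_mul, norm_mul]
      rw [mul_comm]
      exact mul_le_mul_of_nonneg_right (hC' x) (norm_nonneg _)
    · refine (eLpNorm_le_eLpNorm_mul_rpow_measure_univ (by norm_num)
        ((huK k).sub hvK).1).trans (mul_le_mul_left ?_ _)
      exact eLpNorm_le_of_measure_le_smul hcm
  refine tendsto_of_tendsto_of_tendsto_of_le_of_le tendsto_const_nhds ?_ (fun _ => zero_le) hbound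
  have h1 := ENNReal.Tendsto.const_mul (a := c ^ (1 / (2 : ℝ≥0∞)).toReal) huv
    (.inr (ENNReal.rpow_ne_top_of_nonneg ENNReal.toReal_nonneg hc))
  have h2 := ENNReal.Tendsto.mul_const
    (b := volume.restrict K univ ^ (1 / (1 : ℝ≥0∞).toReal - 1 / (2 : ℝ≥0∞).toReal)) h1
    (.inr (ENNReal.rpow_ne_top_of_nonneg (by norm_num) (measure_ne_top _ _)))
  have h3 := ENNReal.Tendsto.const_mul (a := ENNReal.ofReal |C|) h2 (.inr ENNReal.ofReal_ne_top)
  simpa only [mul_zero, zero_mul, smul_eq_mul] using h3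

theorem IsTestFunction.continuous_classicalGradient_apply {φ : EuclideanSpace ℝ (Fin n) → ℂ}
    (hφ : IsTestFunction Ω φ) (i : Fin n) : Continuous fun x => classicalGradient φ x i :=
  (hφ.1.continuous_fderiv (by simp)).clm_apply continuous_const

theorem IsTestFunction.continuous_classicalGradient {φ : EuclideanSpace ℝ (Fin n) → ℂ}
    (hφ : IsTestFunction Ω φ) : Continuous (classicalGradient φ) :=
  (PiLp.continuous_toLp 2 _).comp (continuous_pi fun i => hφ.continuous_classicalGradient_apply i)

theorem classicalGradient_eq_zero_of_notMem_tsupport {φ : EuclideanSpace ℝ (Fin n) → ℂ}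
    {x : EuclideanSpace ℝ (Fin n)} (hx : x ∉ tsupport φ) : classicalGradient φ x = 0 := by
  have : fderiv ℝ φ x = 0 := by
    by_contra h
    exact hx (support_fderiv_subset ℝ h)
  ext i
  simp [classicalGradient, this]

theorem IsTestFunction.hasCompactSupport_classicalGradient {φ : EuclideanSpace ℝ (Fin n) → ℂ}
    (hφ : IsTestFunction Ω φ) : HasCompactSupport (classicalGradient φ) :=
  HasCompactSupport.intro hφ.2.1 fun _ => classicalGradient_eq_zero_of_notMem_tsupport

theorem IsTestFunction.mono {φ : EuclideanSpace ℝ (Fin n) → ℂ} (hφ : IsTestFunction U φ)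
    (hU : U ⊆ Ω) : IsTestFunction Ω φ := ⟨hφ.1, hφ.2.1, hφ.2.2.trans hU⟩

theorem isTestFunction_ofReal {g : EuclideanSpace ℝ (Fin n) → ℝ} (hg : ContDiff ℝ ∞ g)
    (hgc : HasCompactSupport g) (hgΩ : tsupport g ⊆ Ω) :
    IsTestFunction Ω fun x => (g x : ℂ) := by
  refine ⟨Complex.ofRealCLM.contDiff.comp hg, hgc.comp_left Complex.ofReal_zero,
    (closure_mono fun x hx => ?_).trans hgΩ⟩
  exact fun h0 => hx (by simp [h0])

theorem field_apply_memLp (G : L2Field Ω) (i : Fin n) :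
    MemLp (fun x => G x i) 2 (volume.restrict Ω) :=
  (EuclideanSpace.proj (𝕜 := ℂ) i).comp_memLp' (Lp.memLp G)

theorem isWeakGradient_of_tendsto (hm : LocallyDominatesVolume Ω m) {u : ℕ → Lp ℂ 2 m}
    {G : ℕ → L2Field Ω} {v : Lp ℂ 2 m} {F : L2Field Ω} (hu : Tendsto u atTop (𝓝 v))
    (hG : Tendsto G atTop (𝓝 F)) (h : ∀ k, IsWeakGradient Ω (u k) (G k)) :
    IsWeakGradient Ω v F := by
  intro φ hφ i
  have h1 := hm.tendsto_integral_mul (fun k => Lp.memLp (u k)) (Lp.memLp v)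
    ((Lp.tendsto_Lp_iff_tendsto_eLpNorm' _ _).1 hu) hφ.2.1 hφ.2.2
    (hφ.continuous_classicalGradient_apply i)
    (fun x hx => by rw [classicalGradient_eq_zero_of_notMem_tsupport hx]; rfl)
  have hGi : Tendsto (fun k => eLpNorm ((fun x => G k x i) - fun x => F x i) 2
      (volume.restrict Ω)) atTop (𝓝 0) :=
    tendsto_of_tendsto_of_tendsto_of_le_of_le tendsto_const_nhds
      ((Lp.tendsto_Lp_iff_tendsto_eLpNorm' _ _).1 hG) (fun _ => zero_le)
      fun k => eLpNorm_mono fun x => PiLp.norm_apply_le (G k x - F x) i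
  have h2 := locallyDominatesVolume_restrict.tendsto_integral_mul
    (fun k => field_apply_memLp (G k) i) (field_apply_memLp F i) hGi hφ.2.1 hφ.2.2
    hφ.1.continuous (fun x hx => image_eq_zero_of_notMem_tsupport hx)
  refine tendsto_nhds_unique h1 ?_
  simp only [fun k => h k φ hφ i]
  exact h2.neg

theorem IsWeakGradient.unique (hΩ : IsOpen Ω) {u : EuclideanSpace ℝ (Fin n) → ℂ}
    {G F : L2Field Ω} (hG : IsWeakGradient Ω u G) (hF : IsWeakGradient Ω u F) : G = F := by
  have key : ∀ i, ∀ᵐ x ∂volume.restrict Ω, G x i = F x i := by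
    intro i
    have hL : MemLp (fun x => G x i - F x i) 2 (volume.restrict Ω) :=
      (field_apply_memLp G i).sub (field_apply_memLp F i)
    have h1 := hΩ.ae_eq_zero_of_integral_contDiff_smul_eq_zero (μ := volume.restrict Ω)
      ((hL.locallyIntegrable (by norm_num)).locallyIntegrableOn Ω) (fun g hg hgc hgΩ => by
        have hφ := isTestFunction_ofReal hg hgc hgΩ
        have h2 : ∫ x in Ω, G x i * (g x : ℂ) = ∫ x in Ω, F x i * (g x : ℂ) := by
          have := (hG _ hφ i).symm.trans (hF _ hφ i)
          exact neg_injective this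
        have h3 : ∀ x, g x • (G x i - F x i) = G x i * (g x : ℂ) - F x i * (g x : ℂ) := fun x => by
          rw [Complex.real_smul]; ring
        simp only [h3]
        rw [integral_sub (hφ.integrable_field_mul G i) (hφ.integrable_field_mul F i), h2, sub_self])
    filter_upwards [h1, ae_restrict_mem hΩ.measurableSet] with x hx hxΩ
    exact sub_eq_zero.1 (hx hxΩ)
  refine Lp.ext ?_
  filter_upwards [ae_all_iff.2 key] with x hx
  ext i
  exact hx i

theorem IsWeakGradient.weakGradient_eq (hΩ : IsOpen Ω) {u : EuclideanSpace ℝ (Fin n) → ℂ}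
    {G : L2Field Ω} (hG : IsWeakGradient Ω u G) : weakGradient Ω u = G := by
  have h : ∃ G : L2Field Ω, IsWeakGradient Ω u G := ⟨G, hG⟩
  rw [weakGradient, dif_pos h]
  exact h.choose_spec.unique hΩ hG

theorem IsWeakGradient.congr {u v : EuclideanSpace ℝ (Fin n) → ℂ}
    {G F : EuclideanSpace ℝ (Fin n) → EuclideanSpace ℂ (Fin n)} (h : IsWeakGradient Ω u G)
    (huv : u =ᵐ[volume.restrict Ω] v) (hGF : G =ᵐ[volume.restrict Ω] F) :
    IsWeakGradient Ω v F := by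
  intro φ hφ i
  have h1 : ∫ x in Ω, v x * classicalGradient φ x i = ∫ x in Ω, u x * classicalGradient φ x i :=
    integral_congr_ae (by filter_upwards [huv] with x hx; rw [hx])
  have h2 : ∫ x in Ω, F x i * φ x = ∫ x in Ω, G x i * φ x :=
    integral_congr_ae (by filter_upwards [hGF] with x hx; rw [hx])
  rw [h1, h2]
  exact h φ hφ i

theorem IsWeakGradient.add {u v : EuclideanSpace ℝ (Fin n) → ℂ} (hu : IsL2Loc Ω u)
    (hv : IsL2Loc Ω v) {G F : L2Field Ω} (hG : IsWeakGradient Ω u G) (hF : IsWeakGradient Ω v F) :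
    IsWeakGradient Ω (u + v) (G + F : L2Field Ω) := by
  refine IsWeakGradient.congr (G := ⇑G + ⇑F) ?_ .rfl (Lp.coeFn_add G F).symm
  intro φ hφ i
  simp only [Pi.add_apply, PiLp.add_apply, add_mul]
  rw [integral_add (hφ.integrable_field_mul G i) (hφ.integrable_field_mul F i),
    neg_add, ← hG φ hφ i, ← hF φ hφ i,
    ← integral_add (hφ.integrable_mul_classicalGradient hu i)
      (hφ.integrable_mul_classicalGradient hv i)]

theorem IsWeakGradient.const_smul {u : EuclideanSpace ℝ (Fin n) → ℂ} (c : ℂ) {G : L2Field Ω}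
    (hG : IsWeakGradient Ω u G) : IsWeakGradient Ω (c • u) (c • G : L2Field Ω) := by
  refine IsWeakGradient.congr (G := c • ⇑G) ?_ .rfl (Lp.coeFn_smul c G).symm
  intro φ hφ i
  simp only [Pi.smul_apply, PiLp.smul_apply, smul_eq_mul, mul_assoc]
  rw [integral_const_mul, integral_const_mul, ← mul_neg, ← hG φ hφ i]

theorem IsWeakGradient.mono {u : EuclideanSpace ℝ (Fin n) → ℂ}
    {G : EuclideanSpace ℝ (Fin n) → EuclideanSpace ℂ (Fin n)} (h : IsWeakGradient Ω u G)
    (hU : U ⊆ Ω) : IsWeakGradient U u G := by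
  intro φ hφ i
  have h1 := h φ (hφ.mono hU) i
  have hz : ∀ x ∉ U, φ x = 0 ∧ classicalGradient φ x = 0 := fun x hx =>
    ⟨image_eq_zero_of_notMem_tsupport fun h => hx (hφ.2.2 h),
      classicalGradient_eq_zero_of_notMem_tsupport fun h => hx (hφ.2.2 h)⟩
  rw [setIntegral_eq_integral_of_forall_compl_eq_zero
      (fun x hx => by rw [(hz x fun h => hx (hU h)).2]; simp),
    setIntegral_eq_integral_of_forall_compl_eq_zero
      (fun x hx => by rw [(hz x fun h => hx (hU h)).1]; simp)] at h1
  rw [setIntegral_eq_integral_of_forall_compl_eq_zero (fun x hx => by rw [(hz x hx).2]; simp),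
    setIntegral_eq_integral_of_forall_compl_eq_zero (fun x hx => by rw [(hz x hx).1]; simp)]
  exact h1

theorem IsTestFunction.isWeakGradient {φ : EuclideanSpace ℝ (Fin n) → ℂ}
    (hφ : IsTestFunction Ω φ) : IsWeakGradient Ω φ (classicalGradient φ) := by
  intro ψ hψ i
  have hz : ∀ x ∉ Ω, ψ x = 0 ∧ classicalGradient ψ x = 0 := fun x hx =>
    ⟨image_eq_zero_of_notMem_tsupport fun h => hx (hψ.2.2 h),
      classicalGradient_eq_zero_of_notMem_tsupport fun h => hx (hψ.2.2 h)⟩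
  rw [setIntegral_eq_integral_of_forall_compl_eq_zero (fun x hx => by rw [(hz x hx).2]; simp),
    setIntegral_eq_integral_of_forall_compl_eq_zero (fun x hx => by rw [(hz x hx).1]; simp)]
  have hcφ := hφ.1.continuous
  have hcψ := hψ.1.continuous
  have hcφ' := hφ.continuous_classicalGradient_apply i
  have hcψ' := hψ.continuous_classicalGradient_apply i
  refine integral_mul_fderiv_eq_neg_fderiv_mul_of_integrable (v := EuclideanSpace.single i 1)
    ?_ ?_ ?_ (fun x _ => hφ.1.differentiable (by simp) x)
    (fun x _ => hψ.1.differentiable (by simp) x)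
  · exact (hcφ'.mul hcψ).integrable_of_hasCompactSupport (hψ.2.1.mul_left)
  · exact (hcφ.mul hcψ').integrable_of_hasCompactSupport (hφ.2.1.mul_right)
  · exact (hcφ.mul hcψ).integrable_of_hasCompactSupport (hψ.2.1.mul_left)

/-! ### The Dirichlet form on `H¹(Ω, m)` -/

/-- Domination on compact sets makes local square integrability automatic, and `dx ≪ m` lets the
Beppo Levi representative be replaced by `u` itself. -/
theorem mem_sobolevH1_iff (hm : LocallyDominatesVolume Ω m) (hac : volume.restrict Ω ≪ m)
    {u : Lp ℂ 2 m} : u ∈ sobolevH1 Ω m ↔ ∃ G : L2Field Ω, IsWeakGradient Ω u G := by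
  constructor
  · rintro ⟨f, ⟨-, G, hG⟩, huf⟩
    exact ⟨G, hG.congr (hac.ae_eq huf.symm) .rfl⟩
  · rintro ⟨G, hG⟩
    exact ⟨u, ⟨hm.isL2Loc (Lp.memLp u), G, hG⟩, .rfl⟩

/-- The graph of the weak gradient in `L²(Ω, m) × L²(Ω, dx; ℂⁿ)`. -/
def weakGradientGraph (hm : LocallyDominatesVolume Ω m) (hac : volume.restrict Ω ≪ m) :
    Submodule ℂ (WithLp 2 (Lp ℂ 2 m × L2Field Ω)) where
  carrier := {p | IsWeakGradient Ω p.fst p.snd}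
  zero_mem' := by
    have h : IsWeakGradient Ω (0 : EuclideanSpace ℝ (Fin n) → ℂ) 0 := fun φ _ i => by simp
    exact h.congr (hac.ae_eq (Lp.coeFn_zero ℂ 2 m)).symm (Lp.coeFn_zero _ _ _).symm
  add_mem' := fun {p r} hp hr =>
    (IsWeakGradient.add (hm.isL2Loc (Lp.memLp _)) (hm.isL2Loc (Lp.memLp _)) hp hr).congr
      (hac.ae_eq (Lp.coeFn_add p.fst r.fst)).symm .rfl
  smul_mem' := fun c p hp =>
    (IsWeakGradient.const_smul c hp).congr (hac.ae_eq (Lp.coeFn_smul c p.fst)).symm .rfl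

theorem isClosed_weakGradientGraph (hm : LocallyDominatesVolume Ω m)
    (hac : volume.restrict Ω ≪ m) :
    IsClosed (weakGradientGraph hm hac : Set (WithLp 2 (Lp ℂ 2 m × L2Field Ω))) := by
  refine isSeqClosed_iff_isClosed.1 fun p q hp hpq => ?_
  exact isWeakGradient_of_tendsto hm
    (((WithLp.fstL 2 ℂ (Lp ℂ 2 m) (L2Field Ω)).continuous.tendsto q).comp hpq)
    (((WithLp.sndL 2 ℂ (Lp ℂ 2 m) (L2Field Ω)).continuous.tendsto q).comp hpq) hp

/-- The weak gradient as a linear map on `H¹(Ω, m)`. -/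
def weakGradientLinearMap (hΩ : IsOpen Ω) (hm : LocallyDominatesVolume Ω m)
    (hac : volume.restrict Ω ≪ m) : (dirichletForm Ω m).domain →ₗ[ℂ] L2Field Ω where
  toFun u := weakGradient Ω (u : Lp ℂ 2 m)
  map_add' u v := by
    obtain ⟨G, hG⟩ := (mem_sobolevH1_iff hm hac).1 u.2
    obtain ⟨F, hF⟩ := (mem_sobolevH1_iff hm hac).1 v.2
    rw [hG.weakGradient_eq hΩ, hF.weakGradient_eq hΩ]
    exact IsWeakGradient.weakGradient_eq hΩ
      ((IsWeakGradient.add (hm.isL2Loc (Lp.memLp _)) (hm.isL2Loc (Lp.memLp _)) hG hF).congr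
        (hac.ae_eq (Lp.coeFn_add (u : Lp ℂ 2 m) v)).symm .rfl)
  map_smul' c u := by
    obtain ⟨G, hG⟩ := (mem_sobolevH1_iff hm hac).1 u.2
    rw [hG.weakGradient_eq hΩ]
    exact IsWeakGradient.weakGradient_eq hΩ ((IsWeakGradient.const_smul c hG).congr
      (hac.ae_eq (Lp.coeFn_smul c (u : Lp ℂ 2 m))).symm .rfl)

theorem dirichletIntegral_eq_inner (u v : EuclideanSpace ℝ (Fin n) → ℂ) :
    dirichletIntegral Ω u v = ⟪weakGradient Ω u, weakGradient Ω v⟫_ℂ := by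
  rw [L2.inner_def]; rfl

theorem IsTestFunction.memLp (hfin : ∀ K, IsCompact K → K ⊆ Ω → m K < ⊤)
    {φ : EuclideanSpace ℝ (Fin n) → ℂ} (hφ : IsTestFunction Ω φ) : MemLp φ 2 m := by
  have h1 : IsFiniteMeasure (m.restrict (tsupport φ)) :=
    ⟨by simpa using hfin _ hφ.2.1 hφ.2.2⟩
  obtain ⟨C, hC⟩ := hφ.1.continuous.bounded_above_of_compact_support hφ.2.1
  have h2 : MemLp φ 2 (m.restrict (tsupport φ)) :=
    MemLp.of_bound hφ.1.continuous.aestronglyMeasurable C (.of_forall hC)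
  have h3 := (memLp_indicator_iff_restrict (isClosed_tsupport φ).measurableSet).2 h2
  rwa [indicator_eq_self.2 (subset_tsupport φ)] at h3

/-- Since `m` is finite on compact sets, test functions lie in `H¹(Ω, m)`, and a function orthogonal
to all of them vanishes `m`-almost everywhere. -/
theorem dense_sobolevH1 (hΩ : IsOpen Ω) (hm : LocallyDominatesVolume Ω m)
    (hac : volume.restrict Ω ≪ m) (hfin : ∀ K, IsCompact K → K ⊆ Ω → m K < ⊤)
    (hmΩ : m Ωᶜ = 0) : Dense (sobolevH1 Ω m : Set (Lp ℂ 2 m)) := by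
  rw [Submodule.dense_iff_topologicalClosure_eq_top, Submodule.topologicalClosure_eq_top_iff,
    Submodule.eq_bot_iff]
  intro v hv
  have hloc : LocallyIntegrableOn v Ω m := by
    rw [locallyIntegrableOn_iff hΩ.isLocallyClosed]
    intro K hKΩ hK
    have : IsFiniteMeasure (m.restrict K) := ⟨by simpa using hfin K hK hKΩ⟩
    exact ((Lp.memLp v).restrict K).integrable (by norm_num)
  have h1 := hΩ.ae_eq_zero_of_integral_contDiff_smul_eq_zero hloc (fun g hg hgc hgΩ => by
    have hφ := isTestFunction_ofReal hg hgc hgΩ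
    have hL := hφ.memLp hfin
    have hgr : MemLp (classicalGradient fun x => (g x : ℂ)) 2 (volume.restrict Ω) :=
      hφ.continuous_classicalGradient.memLp_of_hasCompactSupport
        hφ.hasCompactSupport_classicalGradient
    have hmem : hL.toLp ∈ sobolevH1 Ω m := (mem_sobolevH1_iff hm hac).2 ⟨hgr.toLp,
      hφ.isWeakGradient.congr (hac.ae_eq hL.coeFn_toLp).symm hgr.coeFn_toLp.symm⟩
    have h2 := (Submodule.mem_orthogonal _ v).1 hv _ hmem
    rw [L2.inner_def] at h2
    rw [← h2]
    refine integral_congr_ae ?_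
    filter_upwards [hL.coeFn_toLp] with x hx
    rw [hx]
    simp [mul_comm])
  refine Lp.ext ?_
  have h2 : ∀ᵐ x ∂m, x ∈ Ω := by rw [ae_iff]; exact hmΩ
  filter_upwards [h1, h2, Lp.coeFn_zero ℂ 2 m] with x hx hxΩ h0
  rw [hx hxΩ, h0]
  rfl

theorem exists_spectralMeasure_dirichletForm (hΩ : IsOpen Ω) (hm : LocallyDominatesVolume Ω m)
    (hac : volume.restrict Ω ≪ m) (hfin : ∀ K, IsCompact K → K ⊆ Ω → m K < ⊤)
    (hmΩ : m Ωᶜ = 0) :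
    ∃ E : ProjectionValuedMeasure (Lp ℂ 2 m), ∃ L : Lp ℂ 2 m →ₗ.[ℂ] Lp ℂ 2 m,
      (dirichletForm Ω m).IsOperatorOf L ∧ E.IsSpectralMeasureOf L :=
  (dirichletForm Ω m).exists_spectralMeasure (weakGradientGraph hm hac)
    (isClosed_weakGradientGraph hm hac) (fun _ => mem_sobolevH1_iff hm hac)
    (fun u g v k hg hk => by
      refine (dirichletIntegral_eq_inner _ _).trans ?_
      exact congrArg₂ (fun a b => ⟪a, b⟫_ℂ) (IsWeakGradient.weakGradient_eq hΩ hk)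
        (IsWeakGradient.weakGradient_eq hΩ hg))
    (dense_sobolevH1 hΩ hm hac hfin hmΩ)

end WeakGradient

/-! ### The weighted measure on a sublevel set -/

section Sublevel

variable {n : ℕ} {Ω : Set (EuclideanSpace ℝ (Fin n))} {V : EuclideanSpace ℝ (Fin n) → ℝ} {e : ℝ}

theorem isOpen_sublevelSet (hΩ : IsOpen Ω) (hV : UpperSemicontinuousOn V Ω) :
    IsOpen (sublevelSet Ω V e) := by
  refine isOpen_iff_mem_nhds.2 fun x hx => ?_
  have h1 := hV x hx.1 e hx.2
  rw [hΩ.nhdsWithin_eq hx.1] at h1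
  filter_upwards [h1, hΩ.mem_nhds hx.1] with y hy hyΩ
  exact ⟨hyΩ, hy⟩

theorem sublevelSet_subset : sublevelSet Ω V e ⊆ Ω := fun _ hx => hx.1

theorem negPart_sub_eq {x : EuclideanSpace ℝ (Fin n)} (hx : x ∈ sublevelSet Ω V e) :
    (V x - e)⁻ = e - V x := by
  rw [negPart_of_nonpos (sub_nonpos.2 hx.2.le), neg_sub]

theorem aemeasurable_sublevel_density (hV : AEMeasurable V (volume.restrict Ω)) :
    AEMeasurable (fun x => ENNReal.ofReal (V x - e)⁻) (volume.restrict (sublevelSet Ω V e)) := by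
  have h1 := hV.mono_measure (Measure.restrict_mono (sublevelSet_subset (V := V) (e := e)) le_rfl)
  simp only [negPart_def]
  exact (((h1.sub_const e).neg).sup_const 0).ennreal_ofReal

theorem volume_restrict_sublevelSet_absolutelyContinuous (hΩ : IsOpen Ω)
    (hVs : UpperSemicontinuousOn V Ω) (hV : AEMeasurable V (volume.restrict Ω)) :
    volume.restrict (sublevelSet Ω V e) ≪ sublevelMeasure Ω V e := by
  refine withDensity_absolutelyContinuous' (aemeasurable_sublevel_density hV) ?_
  filter_upwards [ae_restrict_mem (isOpen_sublevelSet hΩ hVs).measurableSet] with x hx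
  rw [negPart_sub_eq hx]
  exact (ENNReal.ofReal_pos.2 (sub_pos.2 hx.2)).ne'

theorem sublevelMeasure_compl (hΩ : IsOpen Ω) (hVs : UpperSemicontinuousOn V Ω) :
    sublevelMeasure Ω V e (sublevelSet Ω V e)ᶜ = 0 := by
  refine withDensity_absolutelyContinuous _ _ ?_
  rw [Measure.restrict_apply (isOpen_sublevelSet hΩ hVs).measurableSet.compl,
    compl_inter_self, measure_empty]

/-- An upper semicontinuous function attains its maximum on a compact `K ⊆ U_e`, at some `y` with `V
y < e`. The density of `m_e` is then at least `e - V y > 0` on `K`, and the constant is its inverse.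
-/
theorem locallyDominatesVolume_sublevelMeasure (hVs : UpperSemicontinuousOn V Ω) :
    LocallyDominatesVolume (sublevelSet Ω V e) (sublevelMeasure Ω V e) := by
  intro K hK hKU
  rcases K.eq_empty_or_nonempty with rfl | hne
  · exact ⟨1, ENNReal.one_ne_top, by rw [Measure.restrict_empty]; exact Measure.zero_le _⟩
  obtain ⟨y, hyK, hy⟩ := UpperSemicontinuousOn.exists_isMaxOn hne hK
    (hVs.mono (hKU.trans sublevelSet_subset))
  have hpos : 0 < e - V y := sub_pos.2 (hKU hyK).2
  set c := ENNReal.ofReal (e - V y) with hc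
  have hc0 : c ≠ 0 := (ENNReal.ofReal_pos.2 hpos).ne'
  refine ⟨c⁻¹, ENNReal.inv_ne_top.2 hc0, Measure.le_iff.2 fun A hA => ?_⟩
  rw [Measure.smul_apply, smul_eq_mul, Measure.restrict_apply hA]
  have h1 : c * volume (A ∩ K) ≤ sublevelMeasure Ω V e A := by
    calc c * volume (A ∩ K) = ∫⁻ _ in A ∩ K, c := by rw [setLIntegral_const]
      _ ≤ ∫⁻ x in A ∩ K, ENNReal.ofReal (V x - e)⁻ := by
        refine lintegral_mono_ae ?_
        filter_upwards [ae_restrict_mem (hA.inter hK.measurableSet)] with x hx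
        rw [negPart_sub_eq (hKU hx.2)]
        exact ENNReal.ofReal_le_ofReal (sub_le_sub_left (hy hx.2) e)
      _ ≤ ∫⁻ x in A ∩ sublevelSet Ω V e, ENNReal.ofReal (V x - e)⁻ :=
        lintegral_mono_set (inter_subset_inter_right A hKU)
      _ = sublevelMeasure Ω V e A := by
        rw [sublevelMeasure, withDensity_apply _ hA, Measure.restrict_restrict hA]
  calc volume (A ∩ K) = c⁻¹ * (c * volume (A ∩ K)) := by
        rw [← mul_assoc, ENNReal.inv_mul_cancel hc0 ENNReal.ofReal_ne_top, one_mul]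
    _ ≤ c⁻¹ * sublevelMeasure Ω V e A := by gcongr

/-- On `B(x, α)` the kernel `|x - y|^{2-n}` is at least `α^{2-n}`, so a finite Kato supremum bounds
`∫ |V|` over every ball of radius `α`. -/
theorem IsKatoClass.exists_lintegral_ball_lt_top (hn : 2 ≤ n) (hΩ : IsOpen Ω)
    (hV : IsKatoClass Ω V) : ∃ α > 0, ∀ x : EuclideanSpace ℝ (Fin n),
      ∫⁻ y in Ω ∩ Metric.ball x α, ENNReal.ofReal |V y| < ⊤ := by
  have h1 := (hV.2.eventually_lt_const (zero_lt_one)).and self_mem_nhdsWithin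
  obtain ⟨α, hα1, hα⟩ := h1.exists
  refine ⟨α, hα, fun x => ?_⟩
  have hα0 : 0 < α := hα
  have h2 : ∫⁻ y in Ω ∩ Metric.ball x α, ENNReal.ofReal (‖x - y‖ ^ (2 - (n : ℝ)) * |V y|) < 1 :=
    (le_iSup (fun x => ∫⁻ y in Ω ∩ Metric.ball x α,
      ENNReal.ofReal (‖x - y‖ ^ (2 - (n : ℝ)) * |V y|)) x).trans_lt hα1
  have h3 : ∫⁻ y in Ω ∩ Metric.ball x α, ENNReal.ofReal |V y| ≤
      ∫⁻ y in Ω ∩ Metric.ball x α, ENNReal.ofReal (α ^ ((n : ℝ) - 2)) *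
        ENNReal.ofReal (‖x - y‖ ^ (2 - (n : ℝ)) * |V y|) := by
    have hnt : Nonempty (Fin n) := ⟨⟨0, by omega⟩⟩
    refine lintegral_mono_ae ?_
    -- The point `y = x` is discarded: for `n > 2` the real power `0 ^ (2 - n)` is `0` by
    -- convention, which would break the lower bound for the kernel.
    have hne : ∀ᵐ y ∂(volume.restrict (Ω ∩ Metric.ball x α)), y ≠ x :=
      ae_restrict_of_ae (Measure.ae_ne volume x)
    filter_upwards [hne, ae_restrict_mem (hΩ.inter Metric.isOpen_ball).measurableSet] with y hy hyB
    rw [← ENNReal.ofReal_mul (by positivity)]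
    refine ENNReal.ofReal_le_ofReal ?_
    have hpos : 0 < ‖x - y‖ := norm_pos_iff.2 (sub_ne_zero.2 hy.symm)
    have hlt : ‖x - y‖ ≤ α := by
      have := Metric.mem_ball'.1 hyB.2
      rw [dist_eq_norm] at this
      exact this.le
    have hn2 : (2 : ℝ) ≤ n := by exact_mod_cast hn
    have h4 : 1 ≤ α ^ ((n : ℝ) - 2) * ‖x - y‖ ^ (2 - (n : ℝ)) := by
      rw [← neg_sub (n : ℝ) 2, Real.rpow_neg hpos.le, ← div_eq_mul_inv,
        one_le_div (Real.rpow_pos_of_pos hpos _)]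
      exact Real.rpow_le_rpow hpos.le hlt (by linarith)
    rw [← mul_assoc]
    exact le_mul_of_one_le_left (abs_nonneg _) h4
  refine h3.trans_lt ?_
  rw [lintegral_const_mul' _ _ ENNReal.ofReal_ne_top]
  exact ENNReal.mul_lt_top ENNReal.ofReal_lt_top (h2.trans ENNReal.one_lt_top)

/-- Since `e ≤ 0`, the density satisfies `(V - e)₋ ≤ |V|`, which is integrable on small balls;
compactness does the rest. -/
theorem sublevelMeasure_lt_top_of_isCompact (hn : 2 ≤ n) (hΩ : IsOpen Ω)
    (hV : IsKatoClass Ω V) (he : e ≤ 0) {K : Set (EuclideanSpace ℝ (Fin n))} (hK : IsCompact K) :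
    sublevelMeasure Ω V e K < ⊤ := by
  obtain ⟨α, hα, hfin⟩ := hV.exists_lintegral_ball_lt_top hn hΩ
  refine hK.measure_lt_top_of_nhdsWithin fun x _ =>
    ⟨Metric.ball x α, mem_nhdsWithin_of_mem_nhds (Metric.ball_mem_nhds x hα), ?_⟩
  refine lt_of_le_of_lt ?_ (hfin x)
  rw [sublevelMeasure, withDensity_apply _ Metric.isOpen_ball.measurableSet,
    Measure.restrict_restrict Metric.isOpen_ball.measurableSet]
  refine (lintegral_mono_set (t := Ω ∩ Metric.ball x α) ?_).trans (lintegral_mono fun y => ?_)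
  · exact fun y hy => ⟨hy.2.1, hy.1⟩
  · refine ENNReal.ofReal_le_ofReal ?_
    rw [negPart_def]
    refine sup_le ?_ (abs_nonneg _)
    have := neg_le_abs (V y)
    linarith

end Sublevel

/-! ### The Sobolev space `H¹₀` -/

section SobolevH10

variable {n : ℕ} {Ω : Set (EuclideanSpace ℝ (Fin n))}

theorem exists_seq_test_of_mem_closure {u : Lp ℂ 2 (volume.restrict Ω)} {G : L2Field Ω}
    (h : (u, G) ∈ (testGradientGraph Ω).topologicalClosure) :
    ∃ p : ℕ → Lp ℂ 2 (volume.restrict Ω) × L2Field Ω, (∀ k, p k ∈ testGradientGraph Ω) ∧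
      Tendsto (fun k => (p k).1) atTop (𝓝 u) ∧ Tendsto (fun k => (p k).2) atTop (𝓝 G) := by
  obtain ⟨p, hp, hlim⟩ := mem_closure_iff_seq_limit.1 h
  exact ⟨p, hp, (continuous_fst.tendsto _).comp hlim, (continuous_snd.tendsto _).comp hlim⟩

theorem isWeakGradient_of_mem_closure {u : Lp ℂ 2 (volume.restrict Ω)} {G : L2Field Ω}
    (h : (u, G) ∈ (testGradientGraph Ω).topologicalClosure) : IsWeakGradient Ω u G := by
  obtain ⟨p, hp, hu, hG⟩ := exists_seq_test_of_mem_closure h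
  refine isWeakGradient_of_tendsto locallyDominatesVolume_restrict hu hG fun k => ?_
  obtain ⟨φ, hφ, h1, h2⟩ := hp k
  exact hφ.isWeakGradient.congr h1.symm h2.symm

/-- Links the operator norm in the Sobolev inequality to the Euclidean norm of the gradient. The
constant `n` is crude, but only its finiteness matters. -/
theorem norm_fderiv_le_classicalGradient (φ : EuclideanSpace ℝ (Fin n) → ℂ)
    (x : EuclideanSpace ℝ (Fin n)) :
    ‖fderiv ℝ φ x‖ ≤ n * ‖classicalGradient φ x‖ := by
  refine ContinuousLinearMap.opNorm_le_bound _ (by positivity) fun v => ?_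
  have hv : v = ∑ i, v i • EuclideanSpace.single i (1 : ℝ) := by
    simpa using ((EuclideanSpace.basisFun (Fin n) ℝ).sum_repr v).symm
  have h1 : fderiv ℝ φ x v = ∑ i, v i • classicalGradient φ x i := by
    conv_lhs => rw [hv]
    rw [map_sum]
    exact Finset.sum_congr rfl fun i _ => map_smul _ _ _
  rw [h1]
  refine (norm_sum_le _ _).trans ?_
  calc ∑ i, ‖v i • classicalGradient φ x i‖
      ≤ ∑ _i : Fin n, ‖v‖ * ‖classicalGradient φ x‖ := by
        refine Finset.sum_le_sum fun i _ => ?_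
        rw [norm_smul]
        exact mul_le_mul (PiLp.norm_apply_le v i) (PiLp.norm_apply_le _ i) (norm_nonneg _)
          (norm_nonneg _)
    _ = n * ‖classicalGradient φ x‖ * ‖v‖ := by
        rw [Finset.sum_const, Finset.card_univ, Fintype.card_fin, nsmul_eq_mul]; ring

/-- A function in `H¹₀` with vanishing gradient vanishes, by the Sobolev inequality. -/
theorem eq_zero_of_mem_closure_of_gradient_eq_zero (hn : 3 ≤ n)
    {u : Lp ℂ 2 (volume.restrict Ω)}
    (h : (u, (0 : L2Field Ω)) ∈ (testGradientGraph Ω).topologicalClosure) : u = 0 := by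
  obtain ⟨p, hp, hu, hG⟩ := exists_seq_test_of_mem_closure h
  choose φ hφ h1 h2 using hp
  have hnR : (3 : ℝ) ≤ n := by exact_mod_cast hn
  -- The Sobolev exponent `r = 2n/(n - 2)`, from `1/r = 1/2 - 1/n`; it is finite and positive
  -- because `n > 2`.
  let r : NNReal := ⟨((2 : ℝ)⁻¹ - (n : ℝ)⁻¹)⁻¹, inv_nonneg.2 (by
    rw [sub_nonneg]; exact inv_anti₀ (by norm_num) (by linarith))⟩
  have hr0 : (r : ℝ≥0∞) ≠ 0 := by
    have h3 : (0 : ℝ) < ((2 : ℝ)⁻¹ - (n : ℝ)⁻¹)⁻¹ := inv_pos.2 (by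
      rw [sub_pos]; exact inv_strictAnti₀ (by norm_num) (by linarith))
    exact_mod_cast (show r ≠ 0 from fun h0 => h3.ne' (congrArg NNReal.toReal h0))
  have hsob : ∀ k, eLpNorm (φ k) r (volume.restrict Ω) ≤
      (eLpNormLESNormFDerivOfEqInnerConst
        (volume : Measure (EuclideanSpace ℝ (Fin n))) ((2 : NNReal) : ℝ)) *
        (ENNReal.ofReal n * ‖(p k).2‖ₑ) := by
    intro k
    have h3 : eLpNorm (φ k) r volume ≤ _ * eLpNorm (fderiv ℝ (φ k)) ((2 : NNReal) : ℝ≥0∞) volume :=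
      eLpNorm_le_eLpNorm_fderiv_of_eq_inner (volume : Measure (EuclideanSpace ℝ (Fin n)))
        ((hφ k).1.of_le (by simp)) (hφ k).2.1 (p := 2) (p' := r) (by norm_num)
        (by rw [finrank_euclideanSpace_fin]; omega)
        (by rw [finrank_euclideanSpace_fin]; exact inv_inv _)
    refine (eLpNorm_mono_measure _ Measure.restrict_le_self).trans (h3.trans ?_)
    refine mul_le_mul_right ?_ _
    have h4 : eLpNorm (fderiv ℝ (φ k)) 2 volume ≤
        ENNReal.ofReal n * eLpNorm (classicalGradient (φ k)) 2 volume :=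
      eLpNorm_le_mul_eLpNorm_of_ae_le_mul
        (.of_forall fun x => norm_fderiv_le_classicalGradient (φ k) x) 2
    refine h4.trans (mul_le_mul_right (le_of_eq ?_) _)
    have h5 : Function.support (classicalGradient (φ k)) ⊆ Ω := fun x hx => by
      by_contra hxΩ
      exact hx (classicalGradient_eq_zero_of_notMem_tsupport fun h => hxΩ ((hφ k).2.2 h))
    rw [Lp.enorm_def, eLpNorm_congr_ae (h2 k), eLpNorm_restrict_eq_of_support_subset h5]
  have hlim : Tendsto (fun k => eLpNorm (φ k - 0) r (volume.restrict Ω)) atTop (𝓝 0) := by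
    simp only [sub_zero]
    refine tendsto_of_tendsto_of_tendsto_of_le_of_le tendsto_const_nhds ?_ (fun _ => zero_le) hsob
    have h3 : Tendsto (fun k => ‖(p k).2‖ₑ) atTop (𝓝 0) := by
      simpa using hG.enorm
    have h4 := ENNReal.Tendsto.const_mul (a := ENNReal.ofReal n) h3 (.inr ENNReal.ofReal_ne_top)
    have h5 := ENNReal.Tendsto.const_mul (a := ((eLpNormLESNormFDerivOfEqInnerConst
        (volume : Measure (EuclideanSpace ℝ (Fin n))) ((2 : NNReal) : ℝ) : NNReal) : ℝ≥0∞)) h4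
        (.inr ENNReal.coe_ne_top)
    simpa only [mul_zero] using h5
  have hlim2 : Tendsto (fun k => eLpNorm (φ k - ⇑u) 2 (volume.restrict Ω)) atTop (𝓝 0) := by
    refine ((Lp.tendsto_Lp_iff_tendsto_eLpNorm' _ _).1 hu).congr fun k => ?_
    exact eLpNorm_congr_ae ((h1 k).sub .rfl)
  have hmeas : ∀ k, AEStronglyMeasurable (φ k) (volume.restrict Ω) := fun k =>
    (hφ k).1.continuous.aestronglyMeasurable
  -- The test functions tend to `0` in `L^r` and to `u` in `L²`. Both imply convergence in measure,
  -- whose limit is unique almost everywhere. `Ω` may have infinite measure, so the two norms are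
  -- not directly comparable.
  have t1 := tendstoInMeasure_of_tendsto_eLpNorm hr0 hmeas aestronglyMeasurable_zero hlim
  have t2 := tendstoInMeasure_of_tendsto_eLpNorm two_ne_zero hmeas
    (Lp.aestronglyMeasurable u) hlim2
  have h3 := tendstoInMeasure_ae_unique t2 t1
  exact Lp.ext (h3.trans (Lp.coeFn_zero ℂ 2 _).symm)

theorem lp_norm_sq_eq_integral {F : Type*} [NormedAddCommGroup F] [InnerProductSpace ℂ F]
    {μ : Measure (EuclideanSpace ℝ (Fin n))} (u : Lp F 2 μ) :
    ‖u‖ ^ 2 = ∫ x, ‖u x‖ ^ 2 ∂μ := by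
  have h := L2.inner_def (𝕜 := ℂ) u u
  simp only [inner_self_eq_norm_sq_to_K] at h
  have h1 : ((‖u‖ ^ 2 : ℝ) : ℂ) = ((∫ x, ‖u x‖ ^ 2 ∂μ : ℝ) : ℂ) := by
    rw [← integral_complex_ofReal]
    push_cast
    exact h
  exact_mod_cast h1

/-! ### Energy estimates and restriction to the sublevel set -/

variable {V : EuclideanSpace ℝ (Fin n) → ℝ} {e : ℝ}

/-- If the Schrödinger form of `u ∈ H¹₀(Ω)` is at most `e‖u‖²`, then `|u|² V` is integrable and
`∫_Ω |∇u|² ≤ ∫_Ω (e - V)|u|²`. -/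
theorem integrable_and_gradient_le (hn : 3 ≤ n) (hΩ : IsOpen Ω) (he : e ≤ 0)
    {u : Lp ℂ 2 (volume.restrict Ω)} {G : L2Field Ω}
    (hG : (u, G) ∈ (testGradientGraph Ω).topologicalClosure) {r : ℝ}
    (hr : (schrodingerForm Ω V).toFun u u = r) (hre : r ≤ e * ‖u‖ ^ 2) :
    Integrable (fun x => V x * ‖u x‖ ^ 2) (volume.restrict Ω) ∧
      ‖G‖ ^ 2 ≤ ∫ x in Ω, (e - V x) * ‖u x‖ ^ 2 := by
  have h1 : dirichletIntegral Ω u u = ((‖G‖ ^ 2 : ℝ) : ℂ) := by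
    rw [dirichletIntegral_eq_inner, (isWeakGradient_of_mem_closure hG).weakGradient_eq hΩ,
      inner_self_eq_norm_sq_to_K]
    push_cast
    rfl
  have h2 : ∫ x in Ω, (V x : ℂ) * ⟪u x, u x⟫_ℂ = ((∫ x in Ω, V x * ‖u x‖ ^ 2 : ℝ) : ℂ) := by
    rw [← integral_complex_ofReal]
    refine integral_congr_ae (.of_forall fun x => ?_)
    simp only [inner_self_eq_norm_sq_to_K]
    push_cast
    rfl
  have h3 : ‖G‖ ^ 2 + ∫ x in Ω, V x * ‖u x‖ ^ 2 = r := by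
    have h4 : dirichletIntegral Ω u u + ∫ x in Ω, (V x : ℂ) * ⟪u x, u x⟫_ℂ = r := hr
    rw [h1, h2] at h4
    exact_mod_cast h4
  have hint : Integrable (fun x => V x * ‖u x‖ ^ 2) (volume.restrict Ω) := by
    -- The Bochner integral of a non-integrable function is `0`, so in that case the hypothesis
    -- reads `‖∇u‖² ≤ e‖u‖² ≤ 0`. Then `u = 0` by the Sobolev inequality and `V|u|²` is integrable
    -- after all. Form-boundedness of Kato potentials is thereby avoided.
    by_contra hni
    rw [integral_undef hni, add_zero] at h3
    have h4 : ‖G‖ ^ 2 = 0 :=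
      le_antisymm (by nlinarith [mul_nonneg (neg_nonneg.2 he) (sq_nonneg ‖u‖)]) (sq_nonneg _)
    have h5 : G = 0 := by simpa using h4
    rw [h5] at hG
    have hu := eq_zero_of_mem_closure_of_gradient_eq_zero hn hG
    refine hni ((integrable_zero _ _ _).congr ?_)
    filter_upwards [Lp.coeFn_zero ℂ 2 (volume.restrict Ω)] with x hx
    rw [hu, hx]
    simp
  refine ⟨hint, ?_⟩
  have hsq : Integrable (fun x => ‖u x‖ ^ 2) (volume.restrict Ω) :=
    (memLp_two_iff_integrable_sq_norm (Lp.aestronglyMeasurable u)).1 (Lp.memLp u)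
  simp only [sub_mul]
  rw [integral_sub (hsq.const_mul e) hint, integral_const_mul, ← lp_norm_sq_eq_integral]
  linarith

/-- On `U_e` the factor `e - V` is exactly the density of `m_e`; on `Ω \ U_e` it is nonpositive, so
dropping that part can only increase the integral. -/
theorem integrable_sublevelMeasure_and_integral (hΩ : IsOpen Ω) (hVs : UpperSemicontinuousOn V Ω)
    (hV : AEMeasurable V (volume.restrict Ω)) {u : Lp ℂ 2 (volume.restrict Ω)}
    (hint : Integrable (fun x => V x * ‖u x‖ ^ 2) (volume.restrict Ω)) :
    MemLp u 2 (sublevelMeasure Ω V e) ∧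
      ∫ x in Ω, (e - V x) * ‖u x‖ ^ 2 ≤ ∫ x, ‖u x‖ ^ 2 ∂(sublevelMeasure Ω V e) := by
  have hU := (isOpen_sublevelSet (e := e) hΩ hVs).measurableSet
  have hle : volume.restrict (sublevelSet Ω V e) ≤ volume.restrict Ω :=
    Measure.restrict_mono sublevelSet_subset le_rfl
  have hsq : Integrable (fun x => ‖u x‖ ^ 2) (volume.restrict Ω) :=
    (memLp_two_iff_integrable_sq_norm (Lp.aestronglyMeasurable u)).1 (Lp.memLp u)
  have h1 : Integrable (fun x => (e - V x) * ‖u x‖ ^ 2) (volume.restrict Ω) := by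
    simp only [sub_mul]
    exact (hsq.const_mul e).sub hint
  have hdens := aemeasurable_sublevel_density (e := e) hV
  have hfin : ∀ᵐ x ∂volume.restrict (sublevelSet Ω V e), ENNReal.ofReal (V x - e)⁻ < ⊤ :=
    .of_forall fun x => ENNReal.ofReal_lt_top
  have hval : ∀ x ∈ sublevelSet Ω V e, (ENNReal.ofReal (V x - e)⁻).toReal • ‖u x‖ ^ 2 =
      (e - V x) * ‖u x‖ ^ 2 := fun x hx => by
    rw [negPart_sub_eq hx, ENNReal.toReal_ofReal (sub_nonneg.2 hx.2.le), smul_eq_mul]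
  have hae : (fun x => (ENNReal.ofReal (V x - e)⁻).toReal • ‖u x‖ ^ 2)
      =ᵐ[volume.restrict (sublevelSet Ω V e)] fun x => (e - V x) * ‖u x‖ ^ 2 := by
    filter_upwards [ae_restrict_mem hU] with x hx using hval x hx
  constructor
  · have hsm : AEStronglyMeasurable u (sublevelMeasure Ω V e) :=
      ((Lp.aestronglyMeasurable u).mono_measure hle).mono_ac (withDensity_absolutelyContinuous _ _)
    refine (memLp_two_iff_integrable_sq_norm hsm).2 ?_
    refine (integrable_withDensity_iff_integrable_smul₀' hdens hfin).2 ?_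
    exact (h1.mono_measure hle).congr hae.symm
  · have hsplit := setIntegral_union (disjoint_sdiff_right (s := sublevelSet Ω V e) (t := Ω))
      (hΩ.measurableSet.diff hU)
      (h1.mono_measure hle) (h1.mono_measure (Measure.restrict_mono sdiff_subset le_rfl))
    rw [union_sdiff_cancel sublevelSet_subset] at hsplit
    refine hsplit.trans_le ?_
    rw [sublevelMeasure, integral_withDensity_eq_integral_toReal_smul₀ hdens hfin,
      integral_congr_ae hae]
    refine add_le_of_nonpos_right (setIntegral_nonpos (hΩ.measurableSet.diff hU) fun x hx => ?_)
    have h2 : e ≤ V x := not_lt.1 fun h => hx.2 ⟨hx.1, h⟩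
    exact mul_nonpos_of_nonpos_of_nonneg (sub_nonpos.2 h2) (sq_nonneg _)

/-- The restriction to `U_e` of a function on `Ω`, as an element of `L²(U_e, m_e)`. -/
def sublevelRestriction (M : Submodule ℂ (Lp ℂ 2 (volume.restrict Ω)))
    (hM : ∀ u ∈ M, MemLp u 2 (sublevelMeasure Ω V e)) :
    M →ₗ[ℂ] Lp ℂ 2 (sublevelMeasure Ω V e) where
  toFun u := (hM u u.2).toLp
  map_add' u v := by
    rw [← MemLp.toLp_add, MemLp.toLp_eq_toLp_iff]
    exact ((withDensity_absolutelyContinuous _ _).trans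
      (Measure.restrict_mono sublevelSet_subset le_rfl).absolutelyContinuous).ae_eq
      (Lp.coeFn_add (u : Lp ℂ 2 (volume.restrict Ω)) v)
  map_smul' c u := by
    rw [RingHom.id_apply, ← MemLp.toLp_const_smul, MemLp.toLp_eq_toLp_iff]
    exact ((withDensity_absolutelyContinuous _ _).trans
      (Measure.restrict_mono sublevelSet_subset le_rfl).absolutelyContinuous).ae_eq
      (Lp.coeFn_smul c (u : Lp ℂ 2 (volume.restrict Ω)))

end SobolevH10

end

/-! ### Comparison of the Schrödinger and Dirichlet counting functions -/

theorem lemma2p2 (n : ℕ) (hn : 3 ≤ n) (Ω : Set (EuclideanSpace ℝ (Fin n))) (hΩ : IsOpen Ω)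
    (V : EuclideanSpace ℝ (Fin n) → ℝ) (hV_neg : ∀ x ∈ Ω, V x ≤ 0)
    (hV_usc : UpperSemicontinuousOn V Ω) (hV_kato : IsKatoClass Ω V)
    (e : ℝ) (he : e ≤ 0) (l : ℝ) (hl : 1 ≤ l) :
    (schrodingerForm Ω V).countingFunction e ≤
      (dirichletForm (sublevelSet Ω V e) (sublevelMeasure Ω V e)).countingFunction l := by
  have hU : IsOpen (sublevelSet Ω V e) := isOpen_sublevelSet hΩ hV_usc
  have hm : LocallyDominatesVolume (sublevelSet Ω V e) (sublevelMeasure Ω V e) :=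
    locallyDominatesVolume_sublevelMeasure hV_usc
  have hac : volume.restrict (sublevelSet Ω V e) ≪ sublevelMeasure Ω V e :=
    volume_restrict_sublevelSet_absolutelyContinuous hΩ hV_usc hV_kato.1
  refine HilbertForm.countingFunction_le
    (exists_spectralMeasure_dirichletForm hU hm hac
      (fun K hK _ => sublevelMeasure_lt_top_of_isCompact (by omega) hΩ hV_kato he hK)
      (sublevelMeasure_compl hΩ hV_usc))
    (weakGradientLinearMap hU hm hac) (fun u v => dirichletIntegral_eq_inner _ _) fun M hM => ?_
  -- `G` is the gradient on all of `Ω`, not merely on `U_e`; injectivity of the restriction depends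
  -- on this.
  have key : ∀ u ∈ M, ∃ G : L2Field Ω, (u, G) ∈ (testGradientGraph Ω).topologicalClosure ∧
      MemLp u 2 (sublevelMeasure Ω V e) ∧
        ‖G‖ ^ 2 ≤ ∫ x, ‖u x‖ ^ 2 ∂(sublevelMeasure Ω V e) := by
    intro u hu
    obtain ⟨hdom, r, hr, hre⟩ := hM u hu
    obtain ⟨⟨u', G⟩, hG, rfl⟩ := hdom
    obtain ⟨hint, hle⟩ := integrable_and_gradient_le hn hΩ he hG hr hre
    obtain ⟨hLp, hle'⟩ := integrable_sublevelMeasure_and_integral (e := e) hΩ hV_usc hV_kato.1 hint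
    exact ⟨G, hG, hLp, hle.trans hle'⟩
  choose! G hG hLp hle using key
  have hGU : ∀ u, MemLp (G u) 2 (volume.restrict (sublevelSet Ω V e)) := fun u =>
    (Lp.memLp (G u)).mono_measure (Measure.restrict_mono sublevelSet_subset le_rfl)
  let J := sublevelRestriction M hLp
  have hJ : ∀ u : M, J u =ᵐ[sublevelMeasure Ω V e] (u : Lp ℂ 2 (volume.restrict Ω)) :=
    fun u => (hLp u u.2).coeFn_toLp
  have hgrad : ∀ u : M, IsWeakGradient (sublevelSet Ω V e) (J u) (hGU u).toLp := fun u =>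
    ((isWeakGradient_of_mem_closure (hG u u.2)).mono sublevelSet_subset).congr
      (hac.ae_eq (hJ u)).symm (hGU u).coeFn_toLp.symm
  have hJdom : ∀ u : M, J u ∈
      (dirichletForm (sublevelSet Ω V e) (sublevelMeasure Ω V e)).domain := fun u =>
    (mem_sobolevH1_iff hm hac).2 ⟨_, hgrad u⟩
  have hnorm : ∀ u : M, ‖G u‖ ^ 2 ≤ ‖J u‖ ^ 2 := fun u => by
    rw [lp_norm_sq_eq_integral (J u)]
    refine (hle u u.2).trans_eq (integral_congr_ae ?_)
    filter_upwards [hJ u] with x hx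
    rw [hx]
  -- If `u` vanishes on `U_e`, its gradient vanishes on all of `Ω`, and an element of `H¹₀(Ω)` with
  -- zero gradient is zero.
  have hinj : Function.Injective J := by
    rw [← LinearMap.ker_eq_bot, LinearMap.ker_eq_bot']
    intro u hu
    have h1 := hnorm u
    rw [hu, norm_zero, zero_pow two_ne_zero] at h1
    have h2 : G u = 0 := by simpa using le_antisymm h1 (sq_nonneg _)
    have h3 := hG u u.2
    rw [h2] at h3
    exact Subtype.ext (eq_zero_of_mem_closure_of_gradient_eq_zero hn h3)
  refine ⟨LinearMap.codRestrict _ J hJdom, fun u v h => hinj (congrArg Subtype.val h),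
    fun u => ?_⟩
  · have h1 : weakGradientLinearMap hU hm hac (LinearMap.codRestrict _ J hJdom u) =
        (hGU u).toLp := (hgrad u).weakGradient_eq hU
    rw [h1]
    -- The Dirichlet integral only decreases when the domain shrinks from `Ω` to `U_e`.
    have h2 : ‖(hGU u).toLp‖ ≤ ‖G u‖ := by
      rw [Lp.norm_toLp, Lp.norm_def]
      exact ENNReal.toReal_mono (Lp.eLpNorm_ne_top _)
        (eLpNorm_mono_measure _ (Measure.restrict_mono sublevelSet_subset le_rfl))
    calc ‖(hGU u).toLp‖ ^ 2 ≤ ‖G u‖ ^ 2 := by gcongr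
      _ ≤ ‖J u‖ ^ 2 := hnorm u
      _ ≤ l * ‖J u‖ ^ 2 := le_mul_of_one_le_left (sq_nonneg _) hl
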